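/- Let $(W,S)$ be a Coxeter system with $S$ finite, and let $X$ be a building of type $(W,S)$ that is locally finite, i.e. every $\{s\}$-residue ($s\in S$) is finite. Let $\mathcal A$ be its set of apartments (any system of apartments: a set of isomorphic copies of the Coxeter complex of $(W,S)$ in $X$ such that any two chambers of $X$ lie in a common one). Let $|X|$ be the Davis realisation of $X$: the geometric realisation of the order complex of the poset of spherical residues of $X$ (residues whose type $J\subseteq S$ generates a finite subgroup $W_J$), equipped with its standard piecewise Euclidean ($\mathrm{CAT}(0)$) length metric, in which, for every spherical $T\subseteq S$, the residues of type $T$ correspond to Coxeter polytopes. These are the convex hulls of the orbits $W_Tx$ (in the canonical orthogonal representation of $W_T$) of a point $x$ at distance $\rho_s$ from the wall of each $s\in T$, where $\rho=(\rho_s)_{s\in S}$ is a fixed choice of positive real numbers; the vertex given by a residue of type $J\subseteq T$ is the centre of the corresponding face of type $J$. The realisation $|\Sigma|\subseteq |X|$ of an apartment $\Sigma$, with the restricted metric, is the union of the closed chambers $|C|$, $C$ a chamber of $\Sigma$, where $|C|$ is the union of the simplices all of whose vertices are residues containing $C$. A space $Y$ is called one-ended if for any two proper geodesic rays $r_1,r_2\colon[0,\infty)\to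 Y$ (isometric embeddings that eventually leave every compact set) and any compact $C\subseteq Y$ there is $N\in\mathbb N$ such that $r_1([N,\infty))$ and $r_2([N,\infty))$ are contained in the same path component of $Y\setminus C$. (In particular, a compact space is one-ended in this sense.) Then, for every choice of $\rho$, the Davis realisation $|X|$ is one-ended if and only if $|\Sigma|$ is one-ended for every apartment $\Sigma\in\mathcal A$. -/

import Mathlib

open scoped NNReal ENNReal

/-! ### One-endedness -/

section OneEnded

variable {Y : Type*} [PseudoEMetricSpace Y]

/-- A geodesic ray is an isometry from `[0, ∞)`. -/
def IsGeodesicRay (r : ℝ≥0 → Y) : Prop := Isometry r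

/-- A geodesic ray is proper if it eventually leaves every compact set. -/
def IsProperRay (r : ℝ≥0 → Y) : Prop :=
  IsGeodesicRay r ∧
    ∀ C : Set Y, IsCompact C → ∃ N : ℕ, r '' Set.Ici (N : ℝ≥0) ⊆ Cᶜ

variable (Y) in
/-- A space is one-ended if, for any two proper rays and any compact set `C`, the rays eventually
stay in one and the same path component of the complement of `C`. -/
def IsOneEnded : Prop :=
  ∀ r₁ r₂ : ℝ≥0 → Y, IsProperRay r₁ → IsProperRay r₂ →
    ∀ C : Set Y, IsCompact C → ∃ N : ℕ,
      ∀ x ∈ r₁ '' Set.Ici (N : ℝ≥0), ∀ y ∈ r₂ '' Set.Ici (N : ℝ≥0), JoinedIn Cᶜ x y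

end OneEnded

/-! ### Buildings -/

section Building

variable {S W : Type*} [Group W] {M : CoxeterMatrix S}

/-- The standard parabolic subgroup `W_J` generated by the simple reflections in `J`. -/
def CoxeterSystem.parabolic (cs : CoxeterSystem M W) (J : Set S) : Subgroup W :=
  Subgroup.closure (cs.simple '' J)

/-- A subset `J` of `S` is spherical if `W_J` is finite. -/
def CoxeterSystem.IsSpherical (cs : CoxeterSystem M W) (J : Set S) : Prop :=
  Finite (cs.parabolic J)

/-- A building of type `(W, S)` with set of chambers `Ch`, given by its Weyl distance `δ`. -/
structure WeylBuilding (cs : CoxeterSystem M W) (Ch : Type*) where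
  δ : Ch → Ch → W
  nonempty : Nonempty Ch
  eq_one_iff : ∀ C D, δ C D = 1 ↔ C = D
  eq_or_eq : ∀ (C C' D : Ch) (s : S), δ C' C = cs.simple s →
    δ C' D = cs.simple s * δ C D ∨ δ C' D = δ C D
  eq_of_length : ∀ (C C' D : Ch) (s : S), δ C' C = cs.simple s →
    cs.length (cs.simple s * δ C D) = cs.length (δ C D) + 1 →
    δ C' D = cs.simple s * δ C D
  exists_adjacent : ∀ (C D : Ch) (s : S),
    ∃ C', δ C' C = cs.simple s ∧ δ C' D = cs.simple s * δ C D

namespace WeylBuilding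

variable {cs : CoxeterSystem M W} {Ch : Type*} (X : WeylBuilding cs Ch)

/-- The residue of type `J` containing the chamber `C`. -/
def residue (J : Set S) (C : Ch) : Set Ch := {D | X.δ C D ∈ cs.parabolic J}

/-- A building is locally finite if all its `{s}`-residues are finite. -/
def IsLocallyFinite : Prop := ∀ (s : S) (C : Ch), (X.residue {s} C).Finite

/-- An apartment is (the set of chambers of) a copy of the Coxeter complex of `(W, S)`: the image
of a map from `W` that preserves Weyl distances. -/
def IsApartment (A : Set Ch) : Prop :=
  ∃ α : W → Ch, (∀ v w, X.δ (α v) (α w) = v⁻¹ * w) ∧ A = Set.range α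

/-- A system of apartments: a set of apartments such that any two chambers lie in a common one. -/
def IsApartmentSystem (𝒜 : Set (Set Ch)) : Prop :=
  (∀ A ∈ 𝒜, X.IsApartment A) ∧ ∀ C D : Ch, ∃ A ∈ 𝒜, C ∈ A ∧ D ∈ A

/-! ### The Davis realisation -/

/-- The spherical residues of a building, together with their types. -/
structure SphericalResidue where
  type : Finset S
  carrier : Set Ch
  isSpherical : cs.IsSpherical (type : Set S)
  isResidue : ∃ C, carrier = X.residue (type : Set S) C

/-- The underlying set of the Davis realisation: the points of the geometric realisation (in
barycentric coordinates) of the order complex of the set of spherical residues, ordered by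
inclusion. The parameter `ρ` only enters in the metric. -/
structure DavisRealisation (X : WeylBuilding cs Ch) (ρ : S → ℝ) where
  weight : X.SphericalResidue →₀ ℝ
  nonneg : ∀ R, 0 ≤ weight R
  sum_eq_one : (weight.sum fun _ a => a) = 1
  isChain : IsChain (fun R R' : X.SphericalResidue => R.carrier ⊆ R'.carrier)
    (weight.support : Set X.SphericalResidue)

end WeylBuilding

end Building

section Metric

variable {S W : Type*} [Fintype S] [Group W] {M : CoxeterMatrix S}

/-- The matrix `(- cos (π / m s t))` of the canonical bilinear form on `ℝ ^ S`; the entry is `-1`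
where `m s t` is infinite, which `CoxeterMatrix` encodes as `0`. -/
noncomputable def CoxeterMatrix.cosineMatrix (M : CoxeterMatrix S) : Matrix S S ℝ :=
  Matrix.of fun s t => - Real.cos (Real.pi / (M s t : ℝ))

open Classical in
/-- For spherical `J`, the vector in the span of the simple roots `e s`, `s ∈ J`, whose inner
product with `e s` is `ρ s` for every `s ∈ J`. Up to an isometry, the vector `vertexVector ρ J` is
the centre of the face of type `J` (the convex hull of the orbit `W_J x`) of a Coxeter polytope
(the convex hull of the orbit `W_T x`, where `J ⊆ T` and the vertex `x` has inner product `ρ s`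
with each simple root `e s`, `s ∈ T`, that is, distance `ρ s` to the corresponding wall). The
isometry, `v ↦ x - v`, depends on `T` but not on `J`. -/
noncomputable def CoxeterMatrix.vertexVector (M : CoxeterMatrix S) (ρ : S → ℝ) (J : Finset S) :
    S → ℝ := fun s =>
  if h : s ∈ J then
    ((M.cosineMatrix.submatrix (Subtype.val : J → S) (Subtype.val : J → S))⁻¹.mulVec
      (fun t : J => ρ t)) ⟨s, h⟩
  else 0

namespace WeylBuilding

variable {cs : CoxeterSystem M W} {Ch : Type*} {X : WeylBuilding cs Ch} {ρ : S → ℝ}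

namespace DavisRealisation

/-- The position of a point, obtained by extending `vertexVector` affinely to each simplex. -/
noncomputable def position (x : X.DavisRealisation ρ) : S → ℝ :=
  x.weight.sum fun R a => a • M.vertexVector ρ R.type

/-- Two points lie in a common closed simplex. -/
def InCommonSimplex (x y : X.DavisRealisation ρ) : Prop :=
  IsChain (fun R R' : X.SphericalResidue => R.carrier ⊆ R'.carrier)
    ((x.weight.support : Set X.SphericalResidue) ∪ (y.weight.support : Set X.SphericalResidue))

open Classical in
/-- The Euclidean distance of two points of a common simplex; `∞` for other pairs of points. -/
noncomputable def simplexDist (x y : X.DavisRealisation ρ) : ℝ≥0∞ :=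
  if InCommonSimplex x y then
    ENNReal.ofReal (Real.sqrt
      ((x.position - y.position) ⬝ᵥ M.cosineMatrix.mulVec (x.position - y.position)))
  else ⊤

theorem simplexDist_comm (x y : X.DavisRealisation ρ) : simplexDist x y = simplexDist y x := by
  have h : InCommonSimplex x y ↔ InCommonSimplex y x := by
    unfold InCommonSimplex; rw [Set.union_comm]
  have e : x.position - y.position = -(y.position - x.position) := by abel
  unfold simplexDist
  rw [e, Matrix.mulVec_neg, neg_dotProduct, dotProduct_neg, neg_neg]
  by_cases hc : InCommonSimplex y x
  · rw [if_pos hc, if_pos (h.2 hc)]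
  · rw [if_neg hc, if_neg (fun h' => hc (h.1 h'))]

/-- The piecewise Euclidean length metric: the infimum of the lengths of the strings of points
from `x` to `y` in which consecutive points lie in a common simplex. -/
noncomputable def davisDist (x y : X.DavisRealisation ρ) : ℝ≥0∞ :=
  ⨅ (n : ℕ) (z : ℕ → X.DavisRealisation ρ) (_ : z 0 = x) (_ : z n = y),
    ∑ i ∈ Finset.range n, simplexDist (z i) (z (i + 1))

theorem davisDist_le {x y : X.DavisRealisation ρ} (n : ℕ) (z : ℕ → X.DavisRealisation ρ)
    (h0 : z 0 = x) (hn : z n = y) :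
    davisDist x y ≤ ∑ i ∈ Finset.range n, simplexDist (z i) (z (i + 1)) :=
  iInf_le_of_le n <| iInf_le_of_le z <| iInf_le_of_le h0 <| iInf_le_of_le hn le_rfl

theorem davisDist_self (x : X.DavisRealisation ρ) : davisDist x x = 0 :=
  le_antisymm (by simpa using davisDist_le 0 (fun _ => x) rfl rfl) bot_le

theorem davisDist_symm_le (x y : X.DavisRealisation ρ) : davisDist x y ≤ davisDist y x := by
  conv_rhs => unfold davisDist
  refine le_iInf fun n => le_iInf fun z => le_iInf fun h0 => le_iInf fun hn => ?_
  refine (davisDist_le n (fun i => z (n - i)) (by simpa using hn) (by simpa using h0)).trans ?_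
  rw [← Finset.sum_range_reflect (fun i => simplexDist (z i) (z (i + 1)))]
  refine le_of_eq (Finset.sum_congr rfl fun i hi => ?_)
  have hi' := Finset.mem_range.1 hi
  rw [simplexDist_comm]
  congr 2 <;> omega

theorem davisDist_triangle (x y w : X.DavisRealisation ρ) :
    davisDist x w ≤ davisDist x y + davisDist y w := by
  have key : ∀ (n : ℕ) (z : ℕ → X.DavisRealisation ρ), z 0 = x → z n = y →
      ∀ (m : ℕ) (z' : ℕ → X.DavisRealisation ρ), z' 0 = y → z' m = w →
      davisDist x w ≤ ∑ i ∈ Finset.range n, simplexDist (z i) (z (i + 1)) +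
        ∑ i ∈ Finset.range m, simplexDist (z' i) (z' (i + 1)) := by
    intro n z h0 hn m z' h0' hm
    refine (davisDist_le (n + m) (fun i => if i ≤ n then z i else z' (i - n))
      (by simpa using h0) ?_).trans ?_
    · by_cases h : m = 0
      · subst h; simp [hn, ← hm, h0']
      · simp [h, hm]
    · rw [Finset.sum_range_add]
      refine add_le_add (le_of_eq (Finset.sum_congr rfl fun i hi => ?_))
        (le_of_eq (Finset.sum_congr rfl fun i hi => ?_))
      · have hi' := Finset.mem_range.1 hi
        simp [hi'.le, Nat.succ_le_of_lt hi']
      · rcases Nat.eq_zero_or_pos i with h | h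
        · subst h; simp [hn, h0']
        · have h1 : ¬ (n + i ≤ n) := by omega
          have h2 : ¬ (n + i + 1 ≤ n) := by omega
          have h3 : n + i + 1 - n = i + 1 := by omega
          simp [h2, h3, h.ne']
  conv_rhs => unfold davisDist
  simp only [ENNReal.iInf_add, ENNReal.add_iInf]
  exact le_iInf fun m => le_iInf fun z' => le_iInf fun h0' => le_iInf fun hm =>
    le_iInf fun n => le_iInf fun z => le_iInf fun h0 => le_iInf fun hn =>
      key n z h0 hn m z' h0' hm

noncomputable instance : PseudoEMetricSpace (X.DavisRealisation ρ) where
  edist := davisDist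
  edist_self := davisDist_self
  edist_comm x y := le_antisymm (davisDist_symm_le x y) (davisDist_symm_le y x)
  edist_triangle := davisDist_triangle

end DavisRealisation

variable (X) (ρ) in
/-- The realisation of a closed chamber: the points all of whose vertices are residues
containing the chamber. -/
def chamberRealisation (C : Ch) : Set (X.DavisRealisation ρ) :=
  {x | ∀ R ∈ x.weight.support, C ∈ R.carrier}

variable (X) (ρ) in
/-- The realisation of an apartment as a subspace of the Davis realisation: the union of its
closed chambers. -/
def apartmentRealisation (A : Set Ch) : Set (X.DavisRealisation ρ) :=
  ⋃ C ∈ A, X.chamberRealisation ρ C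

end WeylBuilding

end Metric

/-!
Let `W` act on itself as the thin building `thin cs` (the Coxeter complex). An apartment is given by
a map `α : W → Ch` that preserves Weyl distances, and `δ (α 1) : Ch → W` is a retraction onto it.
Both maps are type-preserving, so they induce simplicial maps of Davis realisations that are
isometric on simplices and hence do not increase distances. Thus every apartment is an isometric
copy of the realisation of `thin cs` and a retract of `|X|`, and by local finiteness the preimage of
a compact set under the retraction is relatively compact. Paths in `|X|` that avoid a compact set
can therefore be pushed into the apartment, so that one-endedness of `|X|` passes to apartments
(`IsOneEnded.of_retraction`, `isOneEnded_apartmentRealisation`).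

For the converse, one-endedness is compared with a combinatorial condition on galleries
(`IsGalleryOneEnded`): for every finite set `F` of chambers, all chambers outside some larger finite
set are joined to each other by galleries that avoid `F`.

* If the realisation is one-ended, then so is the chamber system
  (`isGalleryOneEnded_of_isOneEnded`). Only finitely many components of the complement of `F` meet
  the boundary of `F`, so all but finitely many chambers lie in infinite components, and each
  infinite component contains a geodesic ray from some time on: a limit of curves of nearly minimal
  length to points farther and farther away (`IsClosedOutside.exists_isProperRay`). Two components
  that contain the ends of two rays coincide, because unions of closed chambers are closed and the
  closed chambers at a point form a residue, which is gallery-connected.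
* The condition passes from `thin cs` to `X` (`isGalleryOneEnded_of_thin`): two chambers lie in a
  common apartment, and a ball of radius `n` in `X` meets it in a set of diameter at most `2 n`.
* If the chamber system is one-ended, then so is `|X|` (`isOneEnded_of_isGalleryOneEnded`), since a
  compact set meets only finitely many closed chambers.

These arguments need control of the length metric from below. It comes from the fact that the
barycentric coordinates are Lipschitz functions on all of `|X|` with a uniform constant
(`exists_lipschitzWith_weight`). In a simplex this is Euclidean geometry: the canonical form is
positive definite on the span of the simple roots of a finite parabolic subgroup
(`CoxeterSystem.IsSpherical.dotProduct_pos`), and the successive edges of a simplex are nonzero and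
mutually orthogonal (`CoxeterSystem.abs_le_of_chain`). Consequently points at distance less than
some fixed `ε` share a vertex (`exists_edist_bound`), bounded sets meet only finitely many closed
chambers, and unions of closed chambers are closed.

For an arbitrary set `F` of chambers, `X.apartmentRealisation ρ F` serves as the union of the closed
chambers of `F`.
-/

/-! ### Galleries and residues -/

section Combinatorics

variable {S W : Type*} [Group W] {M : CoxeterMatrix S} {cs : CoxeterSystem M W}

theorem CoxeterSystem.simple_ne_one (cs : CoxeterSystem M W) (s : S) : cs.simple s ≠ 1 := by
  intro h
  have := cs.length_simple s
  simp [h] at this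

theorem CoxeterSystem.simple_mem_parabolic (cs : CoxeterSystem M W) {J : Set S} {s : S}
    (hs : s ∈ J) : cs.simple s ∈ cs.parabolic J :=
  Subgroup.subset_closure ⟨s, hs, rfl⟩

theorem CoxeterSystem.parabolic_mono (cs : CoxeterSystem M W) {J K : Set S} (h : J ⊆ K) :
    cs.parabolic J ≤ cs.parabolic K :=
  Subgroup.closure_mono (Set.image_mono h)

theorem CoxeterSystem.exists_word_of_mem_parabolic (cs : CoxeterSystem M W) {J : Set S} {w : W}
    (hw : w ∈ cs.parabolic J) : ∃ ω : List S, (∀ s ∈ ω, s ∈ J) ∧ w = cs.wordProd ω := by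
  induction hw using Subgroup.closure_induction with
  | mem x hx => obtain ⟨s, hs, rfl⟩ := hx; exact ⟨[s], by simpa using hs, by simp⟩
  | one => exact ⟨[], by simp, by simp⟩
  | mul x y _ _ hx hy =>
    obtain ⟨ω, h, rfl⟩ := hx
    obtain ⟨ω', h', rfl⟩ := hy
    refine ⟨ω ++ ω', fun s hs => ?_, by rw [cs.wordProd_append]⟩
    rcases List.mem_append.1 hs with hs | hs
    exacts [h s hs, h' s hs]
  | inv x _ hx =>
    obtain ⟨ω, h, rfl⟩ := hx
    exact ⟨ω.reverse, by simpa using h, by rw [cs.wordProd_reverse]⟩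

theorem CoxeterSystem.isSpherical_empty (cs : CoxeterSystem M W) :
    cs.IsSpherical ((∅ : Finset S) : Set S) := by
  simp only [IsSpherical, parabolic, Finset.coe_empty, Set.image_empty, Subgroup.closure_empty]
  infer_instance

theorem CoxeterSystem.isSpherical_singleton (cs : CoxeterSystem M W) (s : S) :
    cs.IsSpherical (({s} : Finset S) : Set S) := by
  simp only [IsSpherical, parabolic, Finset.coe_singleton, Set.image_singleton,
    ← Subgroup.zpowers_eq_closure]
  exact isOfFinOrder_iff_pow_eq_one.2 ⟨2, by norm_num, cs.simple_sq s⟩ |>.finite_zpowers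

theorem CoxeterSystem.finite_setOf_length_le [Finite S] (cs : CoxeterSystem M W) (n : ℕ) :
    {w : W | cs.length w ≤ n}.Finite := by
  refine ((List.finite_length_le S n).image cs.wordProd).subset fun w hw => ?_
  obtain ⟨ω, hω, rfl⟩ := cs.exists_isReduced w
  exact ⟨ω, by simpa [hω.eq] using hw, rfl⟩

namespace WeylBuilding

variable {Ch : Type*} (X : WeylBuilding cs Ch)

@[simp] theorem δ_self (C : Ch) : X.δ C C = 1 := (X.eq_one_iff C C).2 rfl

theorem δ_eq_simple_symm {C D : Ch} {s : S} (h : X.δ C D = cs.simple s) :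
    X.δ D C = cs.simple s := by
  rcases X.eq_or_eq D C C s h with h' | h'
  · rw [X.δ_self] at h'
    rw [← cs.inv_simple]; exact eq_inv_of_mul_eq_one_right h'.symm
  · rw [X.δ_self] at h'
    have := (X.eq_one_iff D C).1 h'.symm
    subst this
    exact absurd (h.symm.trans (X.δ_self D)) (cs.simple_ne_one s)

/-- There is a gallery of type `ω` from `C` to `D`. -/
def IsGallery : List S → Ch → Ch → Prop
  | [], C, D => C = D
  | s :: ω, C, D => ∃ C', X.δ C C' = cs.simple s ∧ IsGallery ω C' D

variable {X}

theorem IsGallery.append {ω ω' : List S} {C D E : Ch} (h : X.IsGallery ω C D)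
    (h' : X.IsGallery ω' D E) : X.IsGallery (ω ++ ω') C E := by
  induction ω generalizing C with
  | nil => obtain rfl : C = D := h; exact h'
  | cons s ω ih => obtain ⟨C', h1, h2⟩ := h; exact ⟨C', h1, ih h2⟩

theorem IsGallery.reverse {ω : List S} {C D : Ch} (h : X.IsGallery ω C D) :
    X.IsGallery ω.reverse D C := by
  induction ω generalizing C with
  | nil => exact Eq.symm h
  | cons s ω ih =>
    obtain ⟨C', h1, h2⟩ := h
    rw [List.reverse_cons]
    exact (ih h2).append ⟨C, X.δ_eq_simple_symm h1, rfl⟩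

/-- A gallery of reduced type determines the Weyl distance of its ends. -/
theorem IsGallery.δ_eq {ω : List S} {C D : Ch} (h : X.IsGallery ω C D) (hω : cs.IsReduced ω) :
    X.δ C D = cs.wordProd ω := by
  induction ω generalizing C with
  | nil => obtain rfl : C = D := h; simp
  | cons s ω ih =>
    obtain ⟨C', h1, h2⟩ := h
    have hω' : cs.IsReduced ω := by simpa using hω.drop 1
    rw [cs.wordProd_cons, ← ih h2 hω']
    refine X.eq_of_length C' C D s h1 ?_
    rw [ih h2 hω', ← cs.wordProd_cons, hω.eq, hω'.eq, List.length_cons]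

/-- Along a gallery with steps in `J`, the Weyl distance to a fixed chamber changes only by left
multiplication with elements of `W_J`. -/
theorem IsGallery.exists_δ_eq_mul {J : Set S} {ω : List S} {C D : Ch} (h : X.IsGallery ω C D)
    (hω : ∀ s ∈ ω, s ∈ J) (E : Ch) :
    ∃ u ∈ cs.parabolic J, cs.length u ≤ ω.length ∧ X.δ C E = u * X.δ D E := by
  induction ω generalizing C with
  | nil => obtain rfl : C = D := h; exact ⟨1, one_mem _, by simp, by simp⟩
  | cons s ω ih =>
    obtain ⟨C', h1, h2⟩ := h
    obtain ⟨u, hu, hl, e⟩ := ih h2 fun t ht => hω t (List.mem_cons_of_mem _ ht)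
    rcases X.eq_or_eq C' C E s h1 with h | h
    · refine ⟨cs.simple s * u, mul_mem (cs.simple_mem_parabolic (hω s (by simp))) hu, ?_,
        by rw [h, e, mul_assoc]⟩
      have := cs.length_mul_le (cs.simple s) u
      rw [cs.length_simple] at this
      rw [List.length_cons]; omega
    · exact ⟨u, hu, by rw [List.length_cons]; omega, by rw [h, e]⟩

variable (X)

theorem isGallery_of_δ_eq {ω : List S} {C D : Ch} (h : X.δ C D = cs.wordProd ω) :
    X.IsGallery ω C D := by
  induction ω generalizing C with
  | nil => exact (X.eq_one_iff C D).1 (by simpa using h)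
  | cons s ω ih =>
    obtain ⟨C', h1, h2⟩ := X.exists_adjacent C D s
    refine ⟨C', X.δ_eq_simple_symm h1, ih ?_⟩
    rw [h2, h, cs.wordProd_cons, cs.simple_mul_simple_cancel_left]

/-- Reverse a gallery of reduced type. -/
theorem δ_inv (C D : Ch) : (X.δ C D)⁻¹ = X.δ D C := by
  obtain ⟨ω, hω, e⟩ := cs.exists_isReduced (X.δ C D)
  rw [(X.isGallery_of_δ_eq e).reverse.δ_eq hω.reverse, cs.wordProd_reverse, e]

/-- The map `D ↦ δ E D` takes every `J`-residue into a left coset of `W_J`. -/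
theorem inv_δ_mul_δ_mem {J : Set S} {C D : Ch} (h : X.δ C D ∈ cs.parabolic J) (E : Ch) :
    (X.δ E C)⁻¹ * X.δ E D ∈ cs.parabolic J := by
  obtain ⟨ω, hω, e⟩ := cs.exists_word_of_mem_parabolic h
  obtain ⟨u, hu, -, e'⟩ := (X.isGallery_of_δ_eq e).exists_δ_eq_mul hω E
  rwa [X.δ_inv, e', ← X.δ_inv E D, mul_assoc, inv_mul_cancel, mul_one]

theorem length_δ_comm (C D : Ch) : cs.length (X.δ C D) = cs.length (X.δ D C) := by
  rw [← X.δ_inv, cs.length_inv]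

theorem length_δ_triangle (C D E : Ch) :
    cs.length (X.δ C E) ≤ cs.length (X.δ C D) + cs.length (X.δ D E) := by
  obtain ⟨ω, hω, e⟩ := cs.exists_isReduced (X.δ C D)
  obtain ⟨u, -, hu, e'⟩ := (X.isGallery_of_δ_eq e).exists_δ_eq_mul (fun s _ => Set.mem_univ s) E
  rw [e, hω.eq, e']
  exact (cs.length_mul_le _ _).trans (by omega)

theorem δ_mem_parabolic_symm {J : Set S} {C D : Ch} (h : X.δ C D ∈ cs.parabolic J) :
    X.δ D C ∈ cs.parabolic J := by
  rw [← X.δ_inv]; exact inv_mem h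

theorem δ_mem_parabolic_trans {J : Set S} {C D E : Ch} (h : X.δ C D ∈ cs.parabolic J)
    (h' : X.δ D E ∈ cs.parabolic J) : X.δ C E ∈ cs.parabolic J := by
  have := mul_mem h (X.inv_δ_mul_δ_mem h' C)
  rwa [mul_inv_cancel_left] at this

variable {X}

theorem mem_residue_self (J : Set S) (C : Ch) : C ∈ X.residue J C := by
  simp [residue, one_mem]

theorem residue_eq_of_mem {J : Set S} {C D : Ch} (h : D ∈ X.residue J C) :
    X.residue J C = X.residue J D := by
  ext E
  exact ⟨fun hE => X.δ_mem_parabolic_trans (X.δ_mem_parabolic_symm h) hE,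
    fun hE => X.δ_mem_parabolic_trans h hE⟩

theorem SphericalResidue.carrier_eq {R : X.SphericalResidue} {C : Ch} (h : C ∈ R.carrier) :
    R.carrier = X.residue (R.type : Set S) C := by
  obtain ⟨D, hD⟩ := R.isResidue
  rw [hD] at h ⊢
  exact residue_eq_of_mem h

theorem SphericalResidue.carrier_nonempty (R : X.SphericalResidue) : R.carrier.Nonempty := by
  obtain ⟨D, hD⟩ := R.isResidue
  exact ⟨D, hD ▸ mem_residue_self _ _⟩

theorem SphericalResidue.ext_of_mem {R R' : X.SphericalResidue} (ht : R.type = R'.type) {C : Ch}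
    (h : C ∈ R.carrier) (h' : C ∈ R'.carrier) : R = R' := by
  have : R.carrier = R'.carrier := by
    rw [SphericalResidue.carrier_eq h, SphericalResidue.carrier_eq h', ht]
  cases R; cases R'; congr

theorem SphericalResidue.δ_mem {R : X.SphericalResidue} {C D : Ch} (h : C ∈ R.carrier)
    (h' : D ∈ R.carrier) : X.δ C D ∈ cs.parabolic (R.type : Set S) := by
  rwa [SphericalResidue.carrier_eq h] at h'

theorem IsLocallyFinite.finite_isGallery (hX : X.IsLocallyFinite) (ω : List S) (C : Ch) :
    {D | X.IsGallery ω C D}.Finite := by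
  induction ω generalizing C with
  | nil => exact (Set.finite_singleton C).subset fun D hD => Eq.symm hD
  | cons s ω ih =>
    refine ((hX s C).biUnion fun C' _ => ih C').subset ?_
    rintro D ⟨C', h1, h2⟩
    refine Set.mem_biUnion (x := C') ?_ h2
    simpa [residue, h1] using cs.simple_mem_parabolic (Set.mem_singleton s)

theorem IsLocallyFinite.finite_δ_mem (hX : X.IsLocallyFinite) (C : Ch) {F : Set W}
    (hF : F.Finite) : {D | X.δ C D ∈ F}.Finite := by
  refine (hF.biUnion fun w _ => (?_ : {D | X.δ C D = w}.Finite)).subset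
    fun D hD => Set.mem_biUnion hD rfl
  obtain ⟨ω, rfl⟩ := cs.wordProd_surjective w
  exact (hX.finite_isGallery ω C).subset fun D hD => X.isGallery_of_δ_eq hD

/-- The finitely many elements of the finite standard parabolic subgroups: the possible Weyl
distances between two chambers of a common spherical residue. -/
theorem _root_.CoxeterSystem.finite_setOf_spherical [Finite S] (cs : CoxeterSystem M W) :
    {w : W | ∃ J : Finset S, cs.IsSpherical (J : Set S) ∧ w ∈ cs.parabolic (J : Set S)}.Finite := by
  have : {w : W | ∃ J : Finset S, cs.IsSpherical (J : Set S) ∧ w ∈ cs.parabolic (J : Set S)} =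
      ⋃ J ∈ {J : Finset S | cs.IsSpherical (J : Set S)}, (cs.parabolic (J : Set S) : Set W) := by
    ext w; simp
  rw [this]
  exact (Set.toFinite _).biUnion fun J hJ => Set.finite_coe_iff.1 hJ

end WeylBuilding

end Combinatorics

/-! ### The geometric representation and finite parabolic subgroups -/

section GeometricRepresentation

variable {S : Type*}

namespace CoxeterMatrix

theorem cosineMatrix_self (M : CoxeterMatrix S) (s : S) : M.cosineMatrix s s = 1 := by
  simp [cosineMatrix]

theorem cosineMatrix_symm (M : CoxeterMatrix S) (s t : S) :
    M.cosineMatrix s t = M.cosineMatrix t s := by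
  simp [cosineMatrix, M.symmetric s t]

theorem cosineMatrix_nonpos (M : CoxeterMatrix S) {s t : S} (h : s ≠ t) :
    M.cosineMatrix s t ≤ 0 := by
  have h1 := M.off_diagonal s t h
  simp only [cosineMatrix, Matrix.of_apply, Left.neg_nonpos_iff]
  apply Real.cos_nonneg_of_neg_pi_div_two_le_of_le
  · have : 0 ≤ Real.pi / (M s t : ℝ) := by positivity
    linarith [Real.pi_pos]
  · rcases Nat.eq_zero_or_pos (M s t) with h0 | h0
    · simp [h0]; positivity
    · have : (2 : ℝ) ≤ M s t := by exact_mod_cast (by omega : 2 ≤ M s t)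
      gcongr

variable [Fintype S]

open Classical in
/-- The linear form `v ↦ 2 B(e s, v)`, the coroot of the simple root `e s`. -/
noncomputable def simpleCoroot (M : CoxeterMatrix S) (s : S) : Module.Dual ℝ (S → ℝ) :=
  (2 : ℝ) • (LinearMap.proj s ∘ₗ Matrix.mulVecLin M.cosineMatrix)

theorem simpleCoroot_apply (M : CoxeterMatrix S) (s : S) (v : S → ℝ) :
    M.simpleCoroot s v = 2 * M.cosineMatrix.mulVec v s := by
  simp [simpleCoroot]

open Classical in
theorem simpleCoroot_single (M : CoxeterMatrix S) (s t : S) :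
    M.simpleCoroot s (Pi.single t 1) = 2 * M.cosineMatrix s t := by
  rw [simpleCoroot_apply, Matrix.mulVec_single_one, Matrix.col_apply]

open Classical in
theorem simpleCoroot_single_self (M : CoxeterMatrix S) (s : S) :
    M.simpleCoroot s (Pi.single s 1) = 2 := by
  rw [simpleCoroot_single, cosineMatrix_self, mul_one]

open Polynomial Polynomial.Chebyshev in
/-- The simple reflections satisfy the Coxeter relations: the product of two of them is a rotation
by the angle `2 π / m`. -/
theorem isLiftable_reflection (M : CoxeterMatrix S) :
    M.IsLiftable fun s => Module.reflection (M.simpleCoroot_single_self s) := by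
  classical
  intro s t
  rcases eq_or_ne s t with rfl | hst
  · rw [M.diagonal, pow_one]
    ext1 v
    exact Module.involutive_reflection _ v
  have h1 := M.off_diagonal s t hst
  have hA : M.cosineMatrix s t = - Real.cos (Real.pi / (M s t : ℝ)) := rfl
  generalize M s t = m at h1 hA
  rcases Nat.lt_or_ge m 3 with hm | hm
  · obtain rfl | rfl : m = 0 ∨ m = 2 := by omega
    · rw [pow_zero]
    · have h0 : M.cosineMatrix s t = 0 := by rw [hA]; simp
      ext1 v
      rw [pow_two]
      simp only [LinearEquiv.mul_apply, Module.reflection_apply, map_sub, map_smul,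
        simpleCoroot_single, cosineMatrix_self, M.cosineMatrix_symm t s, h0]
      change _ = v
      ext u
      simp
      ring
  · ext1 v
    rw [Module.reflection_mul_reflection_pow_apply]
    change _ = v
    set θ : ℝ := 2 * Real.pi / m with hθ
    have hm0 : (0 : ℝ) < m := by positivity
    have ht : M.simpleCoroot s (Pi.single t 1) * M.simpleCoroot t (Pi.single s 1) - 2
        = 2 * Real.cos θ := by
      rw [simpleCoroot_single, simpleCoroot_single, M.cosineMatrix_symm t s, hA, hθ, mul_div_assoc,
        Real.cos_two_mul]
      ring
    rw [ht]
    have hsin : Real.sin θ ≠ 0 := by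
      refine (Real.sin_pos_of_pos_of_lt_pi (by positivity) ?_).ne'
      rw [hθ, div_lt_iff₀ hm0]
      have : (3 : ℝ) ≤ m := by exact_mod_cast hm
      nlinarith [Real.pi_pos]
    have hmθ : m * θ = 2 * Real.pi := by rw [hθ]; field_simp
    rcases Nat.even_or_odd' m with ⟨k, rfl | rfl⟩
    · have h0 : (Chebyshev.S ℝ ((k : ℤ) - 1)).eval (2 * Real.cos θ) = 0 := by
        apply (mul_eq_zero.1 _).resolve_right hsin
        rw [S_two_mul_real_cos]
        push_cast at hmθ ⊢
        rw [show ((k : ℝ) - 1 + 1) * θ = Real.pi by linarith]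
        exact Real.sin_pi
      have e1 : (((2 * k : ℕ) : ℤ) - 2) / 2 = (k : ℤ) - 1 := by omega
      have e2 : (((2 * k : ℕ) : ℤ) - 1) / 2 = (k : ℤ) - 1 := by omega
      rw [e1, e2, h0]
      simp
    · have h0 : (Chebyshev.S ℝ (k : ℤ)).eval (2 * Real.cos θ) +
          (Chebyshev.S ℝ ((k : ℤ) - 1)).eval (2 * Real.cos θ)
          = 0 := by
        apply (mul_eq_zero.1 _).resolve_right hsin
        rw [add_mul, S_two_mul_real_cos, S_two_mul_real_cos]
        push_cast at hmθ ⊢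
        rw [show ((k : ℝ) - 1 + 1) * θ = 2 * Real.pi - (k + 1) * θ by linarith,
          Real.sin_two_pi_sub, add_neg_cancel]
      have e1 : (((2 * k + 1 : ℕ) : ℤ) - 2) / 2 = (k : ℤ) - 1 := by omega
      have e2 : (((2 * k + 1 : ℕ) : ℤ) - 1) / 2 = (k : ℤ) := by omega
      have e3 : (((2 * k + 1 : ℕ) : ℤ) - 3) / 2 = (k : ℤ) - 1 := by omega
      have e4 : (((2 * k + 1 : ℕ) : ℤ)) / 2 = (k : ℤ) := by omega
      rw [e1, e2, e3, e4, h0]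
      simp

end CoxeterMatrix

namespace CoxeterSystem

variable [Fintype S] {W : Type*} [Group W] {M : CoxeterMatrix S} (cs : CoxeterSystem M W)

/-- The geometric representation of a Coxeter group on `ℝ ^ S`. -/
noncomputable def geometricRep : W →* ((S → ℝ) ≃ₗ[ℝ] (S → ℝ)) :=
  cs.lift ⟨_, M.isLiftable_reflection⟩

open Classical in
theorem geometricRep_simple (s : S) (v : S → ℝ) :
    cs.geometricRep (cs.simple s) v =
      v - (2 * M.cosineMatrix.mulVec v s) • Pi.single s 1 := by
  rw [geometricRep, cs.lift_apply_simple, Module.reflection_apply, M.simpleCoroot_apply]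

/-- Elements of `W_J` change only the coordinates in `J`. -/
theorem geometricRep_apply_of_notMem {J : Set S} {w : W} (hw : w ∈ cs.parabolic J) {s : S}
    (hs : s ∉ J) (v : S → ℝ) : cs.geometricRep w v s = v s := by
  classical
  induction hw using Subgroup.closure_induction generalizing v with
  | mem x hx =>
    obtain ⟨t, ht, rfl⟩ := hx
    have : s ≠ t := fun h => hs (h ▸ ht)
    simp [geometricRep_simple, this]
  | one => simp
  | mul x y _ _ hx hy => rw [map_mul, LinearEquiv.mul_apply, hx, hy]
  | inv x _ hx =>
    rw [← hx (cs.geometricRep x⁻¹ v), ← LinearEquiv.mul_apply, ← map_mul, mul_inv_cancel, map_one]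
    rfl

theorem simple_mem_parabolic_iff {J : Set S} {s : S} :
    cs.simple s ∈ cs.parabolic J ↔ s ∈ J := by
  classical
  refine ⟨fun h => ?_, fun h => Subgroup.subset_closure ⟨s, h, rfl⟩⟩
  by_contra hs
  have := cs.geometricRep_apply_of_notMem h hs (Pi.single s 1)
  simp [geometricRep_simple, M.cosineMatrix_self] at this

/-- If `W_J` is finite, then the canonical form is positive definite on the span of the simple
roots in `J`. With respect to a `W_J`-invariant inner product, the simple reflections in `J` are
orthogonal reflections, so the canonical form arises from that inner product by rescaling the
simple roots to unit length. -/
theorem IsSpherical.dotProduct_pos {cs : CoxeterSystem M W} {J : Set S} (hJ : cs.IsSpherical J)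
    {x : S → ℝ} (hx : ∀ s ∉ J, x s = 0) (hx0 : x ≠ 0) :
    0 < x ⬝ᵥ M.cosineMatrix.mulVec x := by
  classical
  have : Finite (cs.parabolic J) := hJ
  have := Fintype.ofFinite (cs.parabolic J)
  -- The `W_J`-invariant inner product, obtained by averaging.
  let ip : (S → ℝ) → (S → ℝ) → ℝ := fun u v =>
    ∑ w : cs.parabolic J, cs.geometricRep w u ⬝ᵥ cs.geometricRep w v
  have ip_pos : ∀ v, v ≠ 0 → 0 < ip v v := fun v hv => by
    refine Finset.sum_pos (fun w _ => ?_) ⟨1, Finset.mem_univ _⟩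
    have h1 : cs.geometricRep w v ≠ 0 := by simpa using hv
    exact lt_of_le_of_ne (Finset.sum_nonneg fun i _ => mul_self_nonneg _)
      (fun h => h1 (dotProduct_self_eq_zero.1 h.symm))
  have ip_inv : ∀ s ∈ J, ∀ u v,
      ip (cs.geometricRep (cs.simple s) u) (cs.geometricRep (cs.simple s) v) = ip u v := by
    intro s hs u v
    refine Fintype.sum_equiv (Equiv.mulRight
      (⟨cs.simple s, Subgroup.subset_closure ⟨s, hs, rfl⟩⟩ : cs.parabolic J)) _ _ fun w => ?_
    simp [map_mul, LinearEquiv.mul_apply]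
  have ip_comm : ∀ u v, ip u v = ip v u := fun u v =>
    Finset.sum_congr rfl fun w _ => dotProduct_comm _ _
  have ip_add : ∀ u v v', ip u (v + v') = ip u v + ip u v' := fun u v v' => by
    simp [ip, Finset.sum_add_distrib, dotProduct_add]
  have ip_smul : ∀ u v (c : ℝ), ip u (c • v) = c * ip u v := fun u v c => by
    simp [ip, Finset.mul_sum, dotProduct_smul]
  let ipL : (S → ℝ) → (S → ℝ) →ₗ[ℝ] ℝ := fun u =>
    { toFun := ip u, map_add' := ip_add u, map_smul' := fun c v => ip_smul u v c }
  let e : S → S → ℝ := fun s => Pi.single s 1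
  have he0 : ∀ s, e s ≠ 0 := fun s h => by simpa [e] using congrFun h s
  -- Compare the two expressions of the reflection `s`, by the canonical form and by `ip`.
  have key : ∀ s ∈ J, ∀ v, ip (e s) v = M.cosineMatrix.mulVec v s * ip (e s) (e s) := by
    intro s hs v
    have h1 := ip_inv s hs (e s) v
    have h2 : cs.geometricRep (cs.simple s) (e s) = (-1 : ℝ) • e s := by
      simp only [geometricRep_simple, e, Matrix.mulVec_single_one, Matrix.col_apply,
        M.cosineMatrix_self]
      module
    have h3 : cs.geometricRep (cs.simple s) v = v + (-(2 * M.cosineMatrix.mulVec v s)) • e s := by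
      rw [geometricRep_simple, neg_smul, ← sub_eq_add_neg]
    rw [h2, h3, ip_comm, ip_smul, ip_comm, ip_add, ip_smul] at h1
    linarith
  -- By symmetry of both forms, simple roots that are not orthogonal have the same `ip`-length.
  have key2 : ∀ s ∈ J, ∀ t ∈ J, M.cosineMatrix s t =
      ip (e s) (e t) / (√(ip (e s) (e s)) * √(ip (e t) (e t))) := by
    intro s hs t ht
    have h1 : ip (e s) (e t) = M.cosineMatrix s t * ip (e s) (e s) := by
      rw [key s hs]; simp [e]
    have h2 : ip (e s) (e t) = M.cosineMatrix s t * ip (e t) (e t) := by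
      rw [ip_comm, key t ht, M.cosineMatrix_symm s t]; simp [e]
    have hq := ip_pos _ (he0 s)
    rcases eq_or_ne (M.cosineMatrix s t) 0 with h0 | h0
    · rw [h1, h0]; simp
    · have : ip (e t) (e t) = ip (e s) (e s) := mul_left_cancel₀ h0 (h2.symm.trans h1)
      rw [this, Real.mul_self_sqrt hq.le, h1, mul_div_cancel_right₀ _ hq.ne']
  let y : S → ℝ := fun s => x s / √(ip (e s) (e s))
  have hy0 : y ≠ 0 := by
    obtain ⟨s, hs⟩ := Function.ne_iff.1 hx0
    refine Function.ne_iff.2 ⟨s, ?_⟩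
    exact div_ne_zero hs (Real.sqrt_pos.2 (ip_pos _ (he0 s))).ne'
  have expand : ∀ u z, ip u z = ∑ s, z s * ip u (e s) := by
    intro u z
    have hz : z = ∑ s, z s • e s := by
      simp [e, ← Pi.single_smul, Finset.univ_sum_single]
    conv_lhs => rw [hz]
    change ipL u _ = _
    rw [map_sum]
    exact Finset.sum_congr rfl fun s _ => ip_smul _ _ _
  have : x ⬝ᵥ M.cosineMatrix.mulVec x = ip y y := by
    rw [expand y y]
    simp_rw [ip_comm y, expand _ y, dotProduct, Matrix.mulVec, dotProduct, Finset.mul_sum]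
    refine Finset.sum_congr rfl fun s _ => Finset.sum_congr rfl fun t _ => ?_
    by_cases hs : s ∈ J
    · by_cases ht : t ∈ J
      · rw [key2 s hs t ht]
        simp only [y]
        field_simp
      · simp [hx t ht, y]
    · simp [hx s hs, y]
  rw [this]
  exact ip_pos y hy0

end CoxeterSystem

end GeometricRepresentation

/-! ### Vertex vectors and the Euclidean shape of the simplices -/

section VertexVector

variable {S W : Type*} [Fintype S] [Group W] {M : CoxeterMatrix S} {cs : CoxeterSystem M W}
  {ρ : S → ℝ}

theorem CoxeterMatrix.dotProduct_cosineMatrix_comm (M : CoxeterMatrix S) (u v : S → ℝ) :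
    u ⬝ᵥ M.cosineMatrix.mulVec v = v ⬝ᵥ M.cosineMatrix.mulVec u := by
  simp_rw [dotProduct, Matrix.mulVec, dotProduct, Finset.mul_sum]
  rw [Finset.sum_comm]
  refine Finset.sum_congr rfl fun s _ => Finset.sum_congr rfl fun t _ => ?_
  rw [M.cosineMatrix_symm]
  ring

omit [Fintype S] in
theorem CoxeterMatrix.vertexVector_of_notMem (M : CoxeterMatrix S) {J : Finset S} {s : S}
    (hs : s ∉ J) : M.vertexVector ρ J s = 0 := by
  simp [vertexVector, hs]

namespace CoxeterSystem.IsSpherical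

omit [Fintype S] in
theorem mono {J K : Set S} (hK : cs.IsSpherical K) (h : J ⊆ K) : cs.IsSpherical J :=
  Set.Finite.subset (s := (cs.parabolic K : Set W)) hK (Subgroup.closure_mono (Set.image_mono h))

theorem dotProduct_nonneg {J : Set S} (hJ : cs.IsSpherical J)
    {x : S → ℝ} (hx : ∀ s ∉ J, x s = 0) : 0 ≤ x ⬝ᵥ M.cosineMatrix.mulVec x := by
  rcases eq_or_ne x 0 with rfl | h
  · simp
  · exact (hJ.dotProduct_pos hx h).le

theorem mulVec_vertexVector {J : Finset S} (hJ : cs.IsSpherical (J : Set S)) {s : S}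
    (hs : s ∈ J) : M.cosineMatrix.mulVec (M.vertexVector ρ J) s = ρ s := by
  classical
  set A := M.cosineMatrix.submatrix (Subtype.val : J → S) (Subtype.val : J → S) with hA
  have ext : ∀ (v : J → ℝ) (x : S → ℝ), (∀ t (h : t ∈ J), x t = v ⟨t, h⟩) → (∀ t ∉ J, x t = 0) →
      ∀ t : J, M.cosineMatrix.mulVec x t = A.mulVec v t := by
    intro v x h1 h2 t
    simp only [Matrix.mulVec, dotProduct, hA, Matrix.submatrix_apply]
    rw [← Finset.sum_subset (Finset.subset_univ J) fun u _ hu => by rw [h2 u hu, mul_zero],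
      ← Finset.sum_coe_sort]
    exact Finset.sum_congr rfl fun u _ => by rw [h1 u u.2]
  have hdet : A.det ≠ 0 := by
    intro h0
    obtain ⟨v, hv, h⟩ := Matrix.exists_mulVec_eq_zero_iff.2 h0
    let x : S → ℝ := fun s => if h : s ∈ J then v ⟨s, h⟩ else 0
    have hx1 : ∀ t (h : t ∈ J), x t = v ⟨t, h⟩ := fun t h => by simp [x, h]
    have hx2 : ∀ t ∉ J, x t = 0 := fun t h => by simp [x, h]
    have hx0 : x ≠ 0 := by
      obtain ⟨t, ht⟩ := Function.ne_iff.1 hv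
      exact Function.ne_iff.2 ⟨t, by rwa [hx1 t t.2]⟩
    refine (hJ.dotProduct_pos (x := x) (fun t ht => hx2 t (by simpa using ht)) hx0).ne' ?_
    refine Finset.sum_eq_zero fun t _ => ?_
    by_cases ht : t ∈ J
    · rw [ext v x hx1 hx2 ⟨t, ht⟩, h]; simp
    · rw [hx2 t ht, zero_mul]
  rw [ext (A⁻¹.mulVec fun t : J => ρ t) (M.vertexVector ρ J)
    (fun t ht => by simp [CoxeterMatrix.vertexVector, ht, hA]) (fun t ht => M.vertexVector_of_notMem ht)
    ⟨s, hs⟩, Matrix.mulVec_mulVec, Matrix.mul_nonsing_inv _ (isUnit_iff_ne_zero.2 hdet),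
    Matrix.one_mulVec]

/-- The coordinates of `vertexVector` are nonnegative, because distinct simple roots enclose
non-acute angles. -/
theorem vertexVector_nonneg {J : Finset S} (hJ : cs.IsSpherical (J : Set S))
    (hρ : ∀ s, 0 < ρ s) (s : S) : 0 ≤ M.vertexVector ρ J s := by
  set c := M.vertexVector ρ J with hc
  let n : S → ℝ := fun s => max (- c s) 0
  let p : S → ℝ := fun s => max (c s) 0
  have hcn : p = c + n := by
    ext s
    simp only [n, p, Pi.add_apply]
    rcases le_total (c s) 0 with h | h
    · rw [max_eq_right h, max_eq_left (by linarith)]; ring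
    · rw [max_eq_left h, max_eq_right (by linarith)]; ring
  have hn : ∀ t ∉ J, n t = 0 := fun t ht => by simp [n, hc, M.vertexVector_of_notMem ht]
  have h1 : 0 ≤ n ⬝ᵥ M.cosineMatrix.mulVec c := Finset.sum_nonneg fun t _ => by
    by_cases ht : t ∈ J
    · rw [hJ.mulVec_vertexVector ht]
      exact mul_nonneg (le_max_right _ _) (hρ t).le
    · rw [hn t ht, zero_mul]
  have h2 : n ⬝ᵥ M.cosineMatrix.mulVec p ≤ 0 := Finset.sum_nonpos fun t _ => by
    rw [Matrix.mulVec, dotProduct, Finset.mul_sum]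
    refine Finset.sum_nonpos fun u _ => ?_
    rcases eq_or_ne t u with rfl | htu
    · have : n t * p t = 0 := by
        simp only [n, p]
        rcases le_total (c t) 0 with h | h
        · rw [max_eq_right h, mul_zero]
        · rw [max_eq_right (a := - c t) (by linarith), zero_mul]
      rw [mul_left_comm, this, mul_zero]
    · have h3 : 0 ≤ n t * p u := mul_nonneg (le_max_right _ _) (le_max_right _ _)
      rw [mul_left_comm]
      exact mul_nonpos_of_nonpos_of_nonneg (M.cosineMatrix_nonpos htu) h3
  rw [hcn, Matrix.mulVec_add, dotProduct_add] at h2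
  have hn0 : n = 0 := by
    by_contra h
    have := hJ.dotProduct_pos (x := n) (fun t ht => hn t (by simpa using ht)) h
    linarith
  have := congrFun hn0 s
  simp only [n, Pi.zero_apply] at this
  have := le_max_left (- c s) 0
  linarith

theorem vertexVector_ne {J K : Finset S} (hK : cs.IsSpherical (K : Set S)) (h : J ⊂ K)
    (hρ : ∀ s, 0 < ρ s) : M.vertexVector ρ K - M.vertexVector ρ J ≠ 0 := by
  obtain ⟨s, hsK, hsJ⟩ := Finset.exists_of_ssubset h
  have hJ : cs.IsSpherical (J : Set S) := hK.mono (by exact_mod_cast h.subset)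
  intro h0
  have h1 := hK.mulVec_vertexVector (ρ := ρ) hsK
  rw [sub_eq_zero.1 h0] at h1
  have h2 : M.cosineMatrix.mulVec (M.vertexVector ρ J) s ≤ 0 := Finset.sum_nonpos fun t _ => by
    rcases eq_or_ne s t with rfl | hst
    · rw [M.vertexVector_of_notMem hsJ, mul_zero]
    · exact mul_nonpos_of_nonpos_of_nonneg (M.cosineMatrix_nonpos hst) (hJ.vertexVector_nonneg hρ t)
  linarith [hρ s]

/-- Edges of a simplex are orthogonal to the vertex vectors that come before them. -/
theorem dotProduct_vertexVector_sub {J K : Finset S} (hK : cs.IsSpherical (K : Set S))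
    (h : J ⊆ K) {u : S → ℝ} (hu : ∀ s ∉ J, u s = 0) :
    u ⬝ᵥ M.cosineMatrix.mulVec (M.vertexVector ρ K - M.vertexVector ρ J) = 0 := by
  have hJ : cs.IsSpherical (J : Set S) := hK.mono (by exact_mod_cast h)
  refine Finset.sum_eq_zero fun t _ => ?_
  by_cases ht : t ∈ J
  · rw [Matrix.mulVec_sub, Pi.sub_apply, hK.mulVec_vertexVector (h ht),
      hJ.mulVec_vertexVector ht, sub_self, mul_zero]
  · rw [hu t ht, zero_mul]

end CoxeterSystem.IsSpherical

/-- The edges of all simplices are bounded below in length, as there are finitely many types. -/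
theorem CoxeterSystem.exists_edge_bound (cs : CoxeterSystem M W) (hρ : ∀ s, 0 < ρ s) :
    ∃ m : ℝ, 0 < m ∧ ∀ J K : Finset S, cs.IsSpherical (K : Set S) → J ⊂ K →
      m ^ 2 ≤ (M.vertexVector ρ K - M.vertexVector ρ J) ⬝ᵥ
        M.cosineMatrix.mulVec (M.vertexVector ρ K - M.vertexVector ρ J) := by
  let q : Finset S × Finset S → ℝ := fun P =>
    (M.vertexVector ρ P.2 - M.vertexVector ρ P.1) ⬝ᵥ
        M.cosineMatrix.mulVec (M.vertexVector ρ P.2 - M.vertexVector ρ P.1)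
  have hq : ∀ P ∈ {P : Finset S × Finset S | cs.IsSpherical (P.2 : Set S) ∧ P.1 ⊂ P.2},
      0 < q P := by
    rintro ⟨J, K⟩ ⟨hK, h⟩
    refine hK.dotProduct_pos (fun s hs => ?_) (hK.vertexVector_ne h hρ)
    rw [Pi.sub_apply, M.vertexVector_of_notMem (by simpa using hs),
      M.vertexVector_of_notMem fun hs' => hs (by simpa using h.subset hs'), sub_zero]
  rcases Set.eq_empty_or_nonempty
    {P : Finset S × Finset S | cs.IsSpherical (P.2 : Set S) ∧ P.1 ⊂ P.2} with h0 | h0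
  · exact ⟨1, one_pos, fun J K hK h => (Set.eq_empty_iff_forall_notMem.1 h0 (J, K) ⟨hK, h⟩).elim⟩
  · obtain ⟨P, hP, hmin⟩ := Set.exists_min_image _ q (Set.toFinite _) h0
    refine ⟨√(q P), Real.sqrt_pos.2 (hq P hP), fun J K hK h => ?_⟩
    rw [Real.sq_sqrt (hq P hP).le]
    exact hmin (J, K) ⟨hK, h⟩

/-- In a Euclidean simplex with vertices `vertexVector ρ (τ i)`, `i ∈ K`, where the types `τ i` form
a chain, consecutive edges are orthogonal. Hence the length of a tangent vector bounds its
barycentric coordinates `a`. -/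
theorem CoxeterSystem.abs_le_of_chain {ι : Type*} {τ : ι → Finset S} {K : Finset ι}
    (hsph : ∀ i ∈ K, cs.IsSpherical (τ i : Set S))
    (hchain : ∀ i ∈ K, ∀ j ∈ K, τ i ⊆ τ j ∨ τ j ⊆ τ i)
    (hinj : ∀ i ∈ K, ∀ j ∈ K, τ i = τ j → i = j) {m : ℝ} (hm0 : 0 < m)
    (hm : ∀ J K : Finset S, cs.IsSpherical (K : Set S) → J ⊂ K →
      m ^ 2 ≤ (M.vertexVector ρ K - M.vertexVector ρ J) ⬝ᵥ
        M.cosineMatrix.mulVec (M.vertexVector ρ K - M.vertexVector ρ J))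
    (a : ι → ℝ) (ha : ∑ i ∈ K, a i = 0) {i : ι} (hi : i ∈ K) :
    |a i| ≤ 2 / m * √((∑ i ∈ K, a i • M.vertexVector ρ (τ i)) ⬝ᵥ
      M.cosineMatrix.mulVec (∑ i ∈ K, a i • M.vertexVector ρ (τ i))) := by
  set p := ∑ i ∈ K, a i • M.vertexVector ρ (τ i) with hp
  set q := p ⬝ᵥ M.cosineMatrix.mulVec p with hq
  have hsub : ∀ i ∈ K, ∀ j ∈ K, (τ i).card ≤ (τ j).card → τ i ⊆ τ j := fun i hi j hj h =>
    (hchain i hi j hj).elim id fun h' => (Finset.eq_of_subset_of_card_le h' h).ge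
  obtain ⟨top, htop, hmax⟩ := Finset.exists_max_image K (fun i => (τ i).card) ⟨i, hi⟩
  have hv : ∀ j ∈ K, ∀ s ∉ τ top, M.vertexVector ρ (τ j) s = 0 := fun j hj s hs =>
    M.vertexVector_of_notMem fun h => hs (hsub j hj top htop (hmax j hj) h)
  -- The inner product of `p` with the edge `d` that leads from the types with fewer than `n`
  -- elements to those with at least `n` elements is the sum of the coordinates of the latter times
  -- the squared length of `d`, so these tail sums are bounded. Coordinates are differences of them.
  have tail : ∀ n : ℕ, |∑ j ∈ K with n ≤ (τ j).card, a j| ≤ 1 / m * √q := by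
    intro n
    set T := ∑ j ∈ K with n ≤ (τ j).card, a j with hT
    have hsum := Finset.sum_filter_add_sum_filter_not K (fun j => n ≤ (τ j).card) a
    have hpos : 0 ≤ 1 / m * √q := by positivity
    rcases (K.filter fun j => n ≤ (τ j).card).eq_empty_or_nonempty with h0 | hup
    · rw [hT, h0]; simpa using hpos
    rcases (K.filter fun j => ¬ n ≤ (τ j).card).eq_empty_or_nonempty with h0 | hlow
    · rw [h0, ha] at hsum
      simp only [Finset.sum_empty, add_zero] at hsum
      rw [hT, hsum]; simpa using hpos
    obtain ⟨k, hk, hkmin⟩ := Finset.exists_min_image _ (fun j => (τ j).card) hup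
    obtain ⟨l, hl, hlmax⟩ := Finset.exists_max_image _ (fun j => (τ j).card) hlow
    rw [Finset.mem_filter] at hk hl
    set d := M.vertexVector ρ (τ k) - M.vertexVector ρ (τ l) with hd
    have hlk : τ l ⊂ τ k := by
      refine (hsub l hl.1 k hk.1 (by omega)).ssubset_of_ne fun h => ?_
      rw [h] at hl
      exact hl.2 hk.2
    have hpd : p ⬝ᵥ M.cosineMatrix.mulVec d = T * (d ⬝ᵥ M.cosineMatrix.mulVec d) := by
      rw [hp, sum_dotProduct, hT, Finset.sum_mul,
        ← Finset.sum_filter_add_sum_filter_not K (fun j => n ≤ (τ j).card)]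
      have hlow0 : ∀ j ∈ K.filter (fun j => ¬ n ≤ (τ j).card),
          (a j • M.vertexVector ρ (τ j)) ⬝ᵥ M.cosineMatrix.mulVec d = 0 := by
        intro j hj
        have hj' := Finset.mem_filter.1 hj
        rw [smul_dotProduct, (hsph k hk.1).dotProduct_vertexVector_sub hlk.subset, smul_zero]
        exact fun s hs => M.vertexVector_of_notMem fun h =>
          hs (hsub j hj'.1 l hl.1 (hlmax j hj) h)
      rw [Finset.sum_eq_zero hlow0, add_zero]
      refine Finset.sum_congr rfl fun j hj => ?_
      have hj' := Finset.mem_filter.1 hj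
      have hkj : τ k ⊆ τ j := hsub k hk.1 j hj'.1 (hkmin j hj)
      rw [smul_dotProduct, smul_eq_mul]
      congr 1
      have e1 : d ⬝ᵥ M.cosineMatrix.mulVec
          (M.vertexVector ρ (τ j) - M.vertexVector ρ (τ k)) = 0 := by
        refine (hsph j hj'.1).dotProduct_vertexVector_sub hkj fun s hs => ?_
        rw [hd, Pi.sub_apply, M.vertexVector_of_notMem hs,
          M.vertexVector_of_notMem fun h => hs (hlk.subset h), sub_zero]
      have e2 : M.vertexVector ρ (τ l) ⬝ᵥ M.cosineMatrix.mulVec d = 0 :=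
        (hsph k hk.1).dotProduct_vertexVector_sub hlk.subset
          fun s hs => M.vertexVector_of_notMem hs
      rw [M.dotProduct_cosineMatrix_comm, sub_dotProduct] at e1
      nth_rewrite 2 [hd]
      rw [sub_dotProduct, e2]
      linarith
    -- Bessel's inequality for the vector `d`.
    have hnn : 0 ≤ (p - T • d) ⬝ᵥ M.cosineMatrix.mulVec (p - T • d) := by
      refine (hsph top htop).dotProduct_nonneg fun s hs => ?_
      have hs' : s ∉ τ top := by simpa using hs
      simp only [hp, hd, Pi.sub_apply, Pi.smul_apply, Finset.sum_apply, smul_eq_mul,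
        hv k hk.1 s hs', hv l hl.1 s hs']
      rw [Finset.sum_eq_zero fun j hj => by rw [hv j hj s hs', mul_zero]]
      ring
    have hexp : (p - T • d) ⬝ᵥ M.cosineMatrix.mulVec (p - T • d) =
        q - T ^ 2 * (d ⬝ᵥ M.cosineMatrix.mulVec d) := by
      have := M.dotProduct_cosineMatrix_comm p d
      simp only [Matrix.mulVec_sub, Matrix.mulVec_smul, sub_dotProduct, dotProduct_sub,
        smul_dotProduct, dotProduct_smul, smul_eq_mul, ← this, hpd, ← hq]
      ring
    have hmd := hm _ _ (hsph k hk.1) hlk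
    rw [← hd] at hmd
    have hle : (|T| * m) ^ 2 ≤ q := by
      rw [mul_pow, sq_abs]
      nlinarith [sq_nonneg T]
    rw [one_div, ← div_eq_inv_mul, le_div_iff₀ hm0]
    exact Real.le_sqrt_of_sq_le hle
  have hai : a i = (∑ j ∈ K with (τ i).card ≤ (τ j).card, a j) -
      ∑ j ∈ K with (τ i).card + 1 ≤ (τ j).card, a j := by
    classical
    have : (K.filter fun j => (τ i).card ≤ (τ j).card) =
        insert i (K.filter fun j => (τ i).card + 1 ≤ (τ j).card) := by
      ext j
      simp only [Finset.mem_filter, Finset.mem_insert]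
      constructor
      · rintro ⟨hj, h⟩
        rcases h.eq_or_lt with h | h
        · exact Or.inl (hinj j hj i hi
            ((hsub j hj i hi h.ge).antisymm (hsub i hi j hj h.le)))
        · exact Or.inr ⟨hj, h⟩
      · rintro (rfl | ⟨hj, h⟩)
        · exact ⟨hi, le_rfl⟩
        · exact ⟨hj, by omega⟩
    rw [this, Finset.sum_insert (by simp)]
    ring
  rw [hai]
  refine (abs_sub _ _).trans ((add_le_add (tail _) (tail _)).trans (le_of_eq ?_))
  ring

end VertexVector

/-! ### The metric of the Davis realisation -/

section Realisation

variable {S W : Type*} [Fintype S] [Group W] {M : CoxeterMatrix S} {cs : CoxeterSystem M W}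
  {Ch : Type*} {X : WeylBuilding cs Ch} {ρ : S → ℝ}

namespace WeylBuilding

theorem SphericalResidue.type_subset {R R' : X.SphericalResidue} (h : R.carrier ⊆ R'.carrier) :
    R.type ⊆ R'.type := by
  intro s hs
  obtain ⟨C, hC⟩ := R.carrier_nonempty
  obtain ⟨D, hD, -⟩ := X.exists_adjacent C C s
  have hCD : X.δ C D = cs.simple s := X.δ_eq_simple_symm hD
  have hDR : D ∈ R.carrier := by
    rw [SphericalResidue.carrier_eq hC]
    simpa [residue, hCD] using cs.simple_mem_parabolic (J := (R.type : Set S)) (by exact_mod_cast hs)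
  have := SphericalResidue.δ_mem (h hC) (h hDR)
  rw [hCD, cs.simple_mem_parabolic_iff] at this
  exact_mod_cast this

namespace DavisRealisation

omit [Fintype S] in
theorem ext_weight {x y : X.DavisRealisation ρ} (h : x.weight = y.weight) : x = y := by
  cases x; cases y; congr

theorem exists_string_of_edist_lt {x y : X.DavisRealisation ρ} {c : ℝ≥0∞} (h : edist x y < c) :
    ∃ (n : ℕ) (z : ℕ → X.DavisRealisation ρ), z 0 = x ∧ z n = y ∧
      ∑ i ∈ Finset.range n, simplexDist (z i) (z (i + 1)) < c := by
  change davisDist x y < c at h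
  simp only [davisDist, iInf_lt_iff] at h
  obtain ⟨n, z, h0, hn, h⟩ := h
  exact ⟨n, z, h0, hn, h⟩

theorem edist_le_simplexDist (x y : X.DavisRealisation ρ) : edist x y ≤ simplexDist x y := by
  change davisDist x y ≤ _
  have := davisDist_le (x := x) (y := y) 1 (fun i => if i = 0 then x else y) (by simp) (by simp)
  simpa using this

/-- A Lipschitz bound need only be checked in each simplex. -/
theorem lipschitzWith_of_simplexDist {Z : Type*} [PseudoEMetricSpace Z]
    {g : X.DavisRealisation ρ → Z} {K : ℝ≥0} (hK : K ≠ 0)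
    (h : ∀ x y, edist (g x) (g y) ≤ K * simplexDist x y) : LipschitzWith K g := by
  intro x y
  rw [← ENNReal.div_le_iff' (by simpa using hK) ENNReal.coe_ne_top]
  refine le_of_forall_gt fun c hc => ?_
  obtain ⟨n, z, rfl, rfl, hz⟩ := exists_string_of_edist_lt hc
  refine lt_of_le_of_lt ?_ hz
  rw [ENNReal.div_le_iff' (by simpa using hK) ENNReal.coe_ne_top, Finset.mul_sum]
  exact (edist_le_range_sum_edist (fun i => g (z i)) n).trans (Finset.sum_le_sum fun i _ => h _ _)

theorem simplexDist_of_inCommonSimplex {x y : X.DavisRealisation ρ} (h : InCommonSimplex x y) :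
    simplexDist x y = ENNReal.ofReal (√((x.position - y.position) ⬝ᵥ
      M.cosineMatrix.mulVec (x.position - y.position))) := if_pos h

theorem simplexDist_eq_top {x y : X.DavisRealisation ρ} (h : ¬ InCommonSimplex x y) :
    simplexDist x y = ⊤ := if_neg h

omit [Fintype S] in
theorem position_eq_sum (x : X.DavisRealisation ρ) {K : Finset X.SphericalResidue}
    (hK : x.weight.support ⊆ K) :
    x.position = ∑ R ∈ K, x.weight R • M.vertexVector ρ R.type :=
  Finsupp.sum_of_support_subset _ hK _ (by simp)

omit [Fintype S] in
theorem sum_weight (x : X.DavisRealisation ρ) {K : Finset X.SphericalResidue}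
    (hK : x.weight.support ⊆ K) : ∑ R ∈ K, x.weight R = 1 :=
  (Finsupp.sum_of_support_subset _ hK _ (by simp)).symm.trans x.sum_eq_one

variable (X) in
/-- Barycentric coordinates are uniformly Lipschitz on the whole of the Davis realisation. -/
theorem exists_lipschitzWith_weight (hρ : ∀ s, 0 < ρ s) :
    ∃ L : ℝ≥0, L ≠ 0 ∧ ∀ R : X.SphericalResidue,
      LipschitzWith L fun x : X.DavisRealisation ρ => x.weight R := by
  classical
  obtain ⟨m, hm0, hm⟩ := cs.exists_edge_bound hρ
  refine ⟨(2 / m).toNNReal, by simpa using hm0, fun R => ?_⟩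
  refine lipschitzWith_of_simplexDist (by simpa using hm0) fun x y => ?_
  by_cases h : InCommonSimplex x y
  swap
  · rw [simplexDist_eq_top h, ENNReal.mul_top (by simpa using hm0)]
    exact le_top
  rw [simplexDist_of_inCommonSimplex h, edist_dist, Real.dist_eq, ← ENNReal.ofReal,
    ← ENNReal.ofReal_mul (by positivity)]
  refine ENNReal.ofReal_le_ofReal ?_
  set K := x.weight.support ∪ y.weight.support with hK
  have hxK : x.weight.support ⊆ K := Finset.subset_union_left
  have hyK : y.weight.support ⊆ K := Finset.subset_union_right
  by_cases hR : R ∈ K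
  swap
  · rw [hK, Finset.mem_union, not_or, Finsupp.notMem_support_iff, Finsupp.notMem_support_iff] at hR
    rw [hR.1, hR.2, sub_zero, abs_zero]
    positivity
  have hch : ∀ i ∈ K, ∀ j ∈ K, i.carrier ⊆ j.carrier ∨ j.carrier ⊆ i.carrier := by
    intro i hi j hj
    rcases eq_or_ne i j with rfl | hij
    · exact Or.inl subset_rfl
    · exact h (by simpa [K] using hi) (by simpa [K] using hj) hij
  have key := cs.abs_le_of_chain (ρ := ρ) (τ := SphericalResidue.type) (K := K)
    (fun i _ => i.isSpherical)
    (fun i hi j hj => (hch i hi j hj).imp SphericalResidue.type_subset SphericalResidue.type_subset)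
    (fun i hi j hj e => by
      rcases hch i hi j hj with h | h
      · obtain ⟨C, hC⟩ := i.carrier_nonempty
        exact SphericalResidue.ext_of_mem e hC (h hC)
      · obtain ⟨C, hC⟩ := j.carrier_nonempty
        exact SphericalResidue.ext_of_mem e (h hC) hC)
    hm0 hm (fun R => x.weight R - y.weight R)
    (by rw [Finset.sum_sub_distrib, x.sum_weight hxK, y.sum_weight hyK, sub_self]) hR
  rw [x.position_eq_sum hxK, y.position_eq_sum hyK, ← Finset.sum_sub_distrib]
  simpa only [sub_smul] using key

end DavisRealisation

/-! ### Type-preserving maps -/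

variable {Ch' : Type*} {X' : WeylBuilding cs Ch'}

variable (X X') in
/-- A map between the sets of chambers of two buildings is type-preserving if it maps every
`J`-residue into a `J`-residue. -/
def IsTypePreserving (f : Ch → Ch') : Prop :=
  ∀ (J : Set S) (C D : Ch), X.δ C D ∈ cs.parabolic J → X'.δ (f C) (f D) ∈ cs.parabolic J

namespace IsTypePreserving

variable {f : Ch → Ch'} (hf : IsTypePreserving X X' f)

/-- The map of spherical residues that is induced by a type-preserving map. A residue goes to the
residue of the same type that contains the image of one, hence of each, of its chambers. -/
def mapResidue (_ : IsTypePreserving X X' f) (R : X.SphericalResidue) : X'.SphericalResidue where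
  type := R.type
  carrier := X'.residue (R.type : Set S) (f R.carrier_nonempty.some)
  isSpherical := R.isSpherical
  isResidue := ⟨_, rfl⟩

omit [Fintype S] in
theorem mem_mapResidue {R : X.SphericalResidue} {C : Ch} (hC : C ∈ R.carrier) :
    f C ∈ (hf.mapResidue R).carrier :=
  hf _ _ _ (SphericalResidue.δ_mem R.carrier_nonempty.some_mem hC)

theorem mapResidue_mono {R R' : X.SphericalResidue} (h : R.carrier ⊆ R'.carrier) :
    (hf.mapResidue R).carrier ⊆ (hf.mapResidue R').carrier := by
  obtain ⟨C, hC⟩ := R.carrier_nonempty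
  rw [SphericalResidue.carrier_eq (hf.mem_mapResidue hC),
    SphericalResidue.carrier_eq (hf.mem_mapResidue (h hC))]
  exact fun D hD => cs.parabolic_mono
    (by exact_mod_cast SphericalResidue.type_subset h : (R.type : Set S) ⊆ R'.type) hD

theorem isChain_image {s : Set X.SphericalResidue}
    (hs : IsChain (fun R R' : X.SphericalResidue => R.carrier ⊆ R'.carrier) s) :
    IsChain (fun R R' : X'.SphericalResidue => R.carrier ⊆ R'.carrier) (hf.mapResidue '' s) := by
  rintro _ ⟨R, hR, rfl⟩ _ ⟨R', hR', rfl⟩ hne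
  exact (hs hR hR' fun h => hne (h ▸ rfl)).imp hf.mapResidue_mono hf.mapResidue_mono

omit [Fintype S] in
theorem support_mapDomain_subset (w : X.SphericalResidue →₀ ℝ) :
    ((w.mapDomain hf.mapResidue).support : Set X'.SphericalResidue) ⊆
      hf.mapResidue '' (w.support : Set X.SphericalResidue) := by
  classical
  rw [← Finset.coe_image]
  exact_mod_cast Finsupp.mapDomain_support

/-- The simplicial map of Davis realisations that is induced by a type-preserving map. -/
noncomputable def map (x : X.DavisRealisation ρ) : X'.DavisRealisation ρ where
  weight := x.weight.mapDomain hf.mapResidue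
  nonneg R := by
    classical
    rw [Finsupp.mapDomain, Finsupp.sum_apply]
    refine Finset.sum_nonneg fun R' _ => ?_
    simp only [Finsupp.single_apply]
    split_ifs
    exacts [x.nonneg R', le_rfl]
  sum_eq_one := by
    rw [Finsupp.sum_mapDomain_index (by simp) (by simp), x.sum_eq_one]
  isChain := (hf.isChain_image x.isChain).mono (hf.support_mapDomain_subset _)

theorem position_map (x : X.DavisRealisation ρ) : (hf.map x).position = x.position :=
  Finsupp.sum_mapDomain_index (by simp) (fun _ _ _ => add_smul _ _ _)

theorem simplexDist_map_le (x y : X.DavisRealisation ρ) :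
    (hf.map x).simplexDist (hf.map y) ≤ x.simplexDist y := by
  by_cases h : x.InCommonSimplex y
  swap
  · rw [DavisRealisation.simplexDist_eq_top h]; exact le_top
  have h' : (hf.map x).InCommonSimplex (hf.map y) := by
    refine (hf.isChain_image h).mono ?_
    rw [Set.image_union]
    exact Set.union_subset_union (hf.support_mapDomain_subset _) (hf.support_mapDomain_subset _)
  rw [DavisRealisation.simplexDist_of_inCommonSimplex h,
    DavisRealisation.simplexDist_of_inCommonSimplex h', hf.position_map, hf.position_map]

theorem lipschitzWith_map : LipschitzWith 1 (hf.map (ρ := ρ)) :=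
  DavisRealisation.lipschitzWith_of_simplexDist one_ne_zero fun x y => by
    rw [ENNReal.coe_one, one_mul]
    exact (DavisRealisation.edist_le_simplexDist _ _).trans (hf.simplexDist_map_le x y)

theorem map_mem_chamberRealisation {x : X.DavisRealisation ρ} {C : Ch}
    (hx : x ∈ X.chamberRealisation ρ C) : hf.map x ∈ X'.chamberRealisation ρ (f C) := by
  intro R hR
  obtain ⟨R', hR', rfl⟩ := hf.support_mapDomain_subset _ (Finset.mem_coe.2 hR)
  exact hf.mem_mapResidue (hx R' hR')

theorem map_map_eq {g : Ch' → Ch} (hg : IsTypePreserving X' X g) {x : X.DavisRealisation ρ}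
    (h : ∀ R ∈ x.weight.support, ∃ C ∈ R.carrier, g (f C) = C) : hg.map (hf.map x) = x := by
  apply DavisRealisation.ext_weight
  change (x.weight.mapDomain hf.mapResidue).mapDomain hg.mapResidue = x.weight
  rw [← Finsupp.mapDomain_comp]
  conv_rhs => rw [← Finsupp.mapDomain_id (v := x.weight)]
  refine Finsupp.mapDomain_congr fun R hR => ?_
  obtain ⟨C, hC, e⟩ := h R hR
  refine SphericalResidue.ext_of_mem (C := C) rfl ?_ hC
  have := hg.mem_mapResidue (hf.mem_mapResidue hC)
  rwa [e] at this

end IsTypePreserving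

/-! ### The Coxeter complex as an apartment -/

variable (cs) in
/-- The thin building of type `(W, S)`: the Coxeter complex. -/
def thin : WeylBuilding cs W where
  δ v w := v⁻¹ * w
  nonempty := ⟨1⟩
  eq_one_iff v w := inv_mul_eq_one
  eq_or_eq v v' w s h := Or.inl (by
    rw [← h]; group)
  eq_of_length v v' w s h _ := by
    rw [← h]; group
  exists_adjacent v w s := ⟨v * cs.simple s, by simp, by simp [mul_assoc]⟩

omit [Fintype S] in
theorem isLocallyFinite_thin : (thin cs).IsLocallyFinite := by
  intro s v
  have : Finite (cs.parabolic {s}) := by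
    have := cs.isSpherical_singleton s
    rwa [Finset.coe_singleton] at this
  refine ((Set.toFinite (cs.parabolic {s} : Set W)).image (v * ·)).subset fun w hw => ?_
  exact ⟨v⁻¹ * w, hw, by group⟩

omit [Fintype S] in
theorem isTypePreserving_of_δ_eq {α : W → Ch} (hα : ∀ v w, X.δ (α v) (α w) = v⁻¹ * w) :
    IsTypePreserving (thin cs) X α := fun J v w h => by rw [hα]; exact h

omit [Fintype S] in
variable (X) in
/-- The map `δ C` is the retraction onto any apartment that contains `C`, centred at `C`, when that
apartment is identified with `W` in such a way that `C` corresponds to `1`. -/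
theorem isTypePreserving_δ (C : Ch) : IsTypePreserving X (thin cs) (X.δ C) :=
  fun _ _ _ h => X.inv_δ_mul_δ_mem h C

end WeylBuilding

end Realisation

/-! ### Curves in the Davis realisation -/

section Curves

variable {S W : Type*} [Fintype S] [Group W] {M : CoxeterMatrix S} {cs : CoxeterSystem M W}
  {Ch : Type*} {X : WeylBuilding cs Ch} {ρ : S → ℝ}

namespace WeylBuilding

namespace DavisRealisation

omit [Fintype S] in
theorem support_lerp_subset (x y : X.DavisRealisation ρ) (a b : ℝ) :
    ((a • x.weight + b • y.weight).support : Set X.SphericalResidue) ⊆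
      (x.weight.support : Set X.SphericalResidue) ∪ y.weight.support := by
  intro R hR
  by_contra h
  simp only [Set.mem_union, Finset.mem_coe, Finsupp.mem_support_iff, not_or, not_not] at h
  simp [h.1, h.2] at hR

/-- The straight line segment between two points of a common simplex. -/
noncomputable def lerp {x y : X.DavisRealisation ρ} (h : InCommonSimplex x y) (t : unitInterval) :
    X.DavisRealisation ρ where
  weight := (1 - t : ℝ) • x.weight + (t : ℝ) • y.weight
  nonneg R := add_nonneg (mul_nonneg (sub_nonneg.2 t.2.2) (x.nonneg R))
    (mul_nonneg t.2.1 (y.nonneg R))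
  sum_eq_one := by
    rw [Finsupp.sum_add_index' (by simp) (by simp), Finsupp.sum_smul_index (by simp),
      Finsupp.sum_smul_index (by simp), ← Finsupp.mul_sum, ← Finsupp.mul_sum, x.sum_eq_one,
      y.sum_eq_one]
    ring
  isChain := h.mono (support_lerp_subset x y _ _)

variable {x y : X.DavisRealisation ρ} (h : InCommonSimplex x y)

omit [Fintype S] in
theorem lerp_zero : lerp h 0 = x := ext_weight (by simp [lerp])

omit [Fintype S] in
theorem lerp_one : lerp h 1 = y := ext_weight (by simp [lerp])

omit [Fintype S] in
theorem lerp_mem_chamberRealisation {C : Ch} (hx : x ∈ X.chamberRealisation ρ C)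
    (hy : y ∈ X.chamberRealisation ρ C) (t : unitInterval) :
    lerp h t ∈ X.chamberRealisation ρ C := fun R hR =>
  (support_lerp_subset x y _ _ (Finset.mem_coe.2 hR)).elim (hx R) (hy R)

omit [Fintype S] in
theorem position_lerp (t : unitInterval) :
    (lerp h t).position = (1 - t : ℝ) • x.position + (t : ℝ) • y.position := by
  simp only [position, lerp]
  rw [Finsupp.sum_add_index' (by simp) (fun _ _ _ => add_smul _ _ _),
    Finsupp.sum_smul_index (by simp), Finsupp.sum_smul_index (by simp), Finsupp.smul_sum,
    Finsupp.smul_sum]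
  simp only [mul_smul]

theorem lipschitzWith_lerp : LipschitzWith (simplexDist x y).toNNReal (lerp h) := by
  intro s t
  refine (edist_le_simplexDist _ _).trans ?_
  have hst : InCommonSimplex (lerp h s) (lerp h t) := h.mono
    (Set.union_subset (support_lerp_subset x y _ _) (support_lerp_subset x y _ _))
  have e : (lerp h s).position - (lerp h t).position =
      ((t : ℝ) - s) • (x.position - y.position) := by
    rw [position_lerp, position_lerp]; module
  rw [simplexDist_of_inCommonSimplex hst, e, simplexDist_of_inCommonSimplex h, Matrix.mulVec_smul,
    smul_dotProduct, dotProduct_smul, smul_eq_mul, smul_eq_mul, ← mul_assoc,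
    Real.sqrt_mul (mul_self_nonneg _), Real.sqrt_mul_self_eq_abs, mul_comm, edist_dist,
    ENNReal.ofReal_mul (Real.sqrt_nonneg _), Subtype.dist_eq, Real.dist_eq, abs_sub_comm (s : ℝ)]
  rfl

include h in
theorem joinedIn_chamberRealisation_of_inCommonSimplex {C : Ch}
    (hx : x ∈ X.chamberRealisation ρ C) (hy : y ∈ X.chamberRealisation ρ C) :
    JoinedIn (X.chamberRealisation ρ C) x y := by
  refine JoinedIn.ofLine (f := fun t => lerp h (Set.projIcc 0 1 zero_le_one t))
    ((lipschitzWith_lerp h).continuous.comp continuous_projIcc).continuousOn ?_ ?_ ?_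
  · rw [Set.projIcc_left]; exact lerp_zero h
  · rw [Set.projIcc_right]; exact lerp_one h
  · rintro _ ⟨t, -, rfl⟩
    exact lerp_mem_chamberRealisation h hx hy _

theorem exists_curve_of_simplexDist_le {x y : X.DavisRealisation ρ} {L : ℝ≥0} (hL : L ≠ 0)
    (hxy : simplexDist x y ≤ L) :
    ∃ γ : ℝ≥0 → X.DavisRealisation ρ, LipschitzWith 1 γ ∧ γ 0 = x ∧ γ L = y := by
  have h : InCommonSimplex x y := by
    by_contra h
    rw [simplexDist_eq_top h] at hxy
    exact ENNReal.coe_ne_top (top_le_iff.1 hxy)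
  refine ⟨fun t => lerp h (Set.projIcc 0 1 zero_le_one ((t : ℝ) / L)), ?_, ?_, ?_⟩
  · have h1 : LipschitzWith L⁻¹ fun t : ℝ≥0 => (t : ℝ) / L := by
      refine LipschitzWith.of_dist_le_mul fun s t => le_of_eq ?_
      rw [Real.dist_eq, ← sub_div, abs_div, NNReal.dist_eq, NNReal.coe_inv, abs_of_nonneg L.coe_nonneg,
        div_eq_inv_mul]
    have h2 := (lipschitzWith_lerp h).comp ((LipschitzWith.projIcc (zero_le_one (α := ℝ))).comp h1)
    refine h2.weaken ?_
    rw [one_mul, ← div_eq_mul_inv]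
    exact div_le_one_of_le₀ ((ENNReal.toNNReal_mono ENNReal.coe_ne_top hxy).trans_eq (ENNReal.toNNReal_coe L)) zero_le
  · simp only [NNReal.coe_zero, zero_div]
    rw [Set.projIcc_left]; exact lerp_zero h
  · simp only [div_self (NNReal.coe_ne_zero.2 hL)]
    rw [Set.projIcc_right]; exact lerp_one h

/-- Concatenation of curves that are parametrised with speed at most one. -/
theorem exists_curve_trans {Y : Type*} [PseudoEMetricSpace Y] {γ γ' : ℝ≥0 → Y}
    (hγ : LipschitzWith 1 γ) (hγ' : LipschitzWith 1 γ') {L : ℝ≥0} (L' : ℝ≥0) (h : γ L = γ' 0) :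
    ∃ η : ℝ≥0 → Y, LipschitzWith 1 η ∧ η 0 = γ 0 ∧ η (L + L') = γ' L' := by
  have hle : ∀ {γ : ℝ≥0 → Y}, LipschitzWith 1 γ → ∀ s t, s ≤ t →
      edist (γ s) (γ t) ≤ (t - s : ℝ≥0) := fun {γ} hγ s t hst => by
    have := hγ s t
    rwa [ENNReal.coe_one, one_mul, edist_nndist s t, NNReal.nndist_eq,
      tsub_eq_zero_of_le hst, max_eq_right zero_le] at this
  let η : ℝ≥0 → Y := fun t => if t ≤ L then γ t else γ' (t - L)
  have hη : ∀ s t, s ≤ t → edist (η s) (η t) ≤ (t - s : ℝ≥0) := by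
    intro s t hst
    by_cases ht : t ≤ L
    · simpa only [η, ht, hst.trans ht, if_true] using hle hγ s t hst
    · by_cases hs : s ≤ L
      · simp only [η, ht, hs, if_true, if_false]
        refine (edist_triangle _ (γ L) _).trans ((add_le_add (hle hγ _ _ hs)
          (h ▸ hle hγ' 0 (t - L) zero_le)).trans ?_)
        rw [tsub_zero, ← ENNReal.coe_add, ENNReal.coe_le_coe, add_comm,
          tsub_add_tsub_cancel (not_le.1 ht).le hs]
      · simp only [η, ht, hs, if_false]
        refine (hle hγ' _ _ (tsub_le_tsub_right hst L)).trans ?_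
        rw [ENNReal.coe_le_coe, tsub_tsub_tsub_cancel_right (not_le.1 hs).le]
  refine ⟨η, ?_, by simp [η], ?_⟩
  · intro s t
    rw [ENNReal.coe_one, one_mul, edist_nndist s t, NNReal.nndist_eq]
    rcases le_total s t with hst | hst
    · exact (hη s t hst).trans (ENNReal.coe_le_coe.2 (le_max_right _ _))
    · rw [edist_comm]
      exact (hη t s hst).trans (ENNReal.coe_le_coe.2 (le_max_left _ _))
  · rcases eq_or_ne L' 0 with rfl | hL'
    · simp [η, h]
    · have : ¬ L + L' ≤ L := by simpa using hL'
      simp [η, this]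

/-- The Davis realisation is a length space: points at distance less than `L` are joined by a curve
that is parametrised on `[0, L]` with speed at most one. The curve is extended to `[0, ∞)`. -/
theorem exists_curve {x y : X.DavisRealisation ρ} {L : ℝ≥0} (hxy : edist x y < L) :
    ∃ γ : ℝ≥0 → X.DavisRealisation ρ, LipschitzWith 1 γ ∧ γ 0 = x ∧ γ L = y := by
  obtain ⟨n, z, rfl, rfl, hz⟩ := exists_string_of_edist_lt hxy
  clear hxy
  induction n generalizing L with
  | zero => exact ⟨fun _ => z 0, (LipschitzWith.const _).weaken zero_le, rfl, rfl⟩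
  | succ n ih =>
    rw [Finset.sum_range_succ] at hz
    set a := ∑ i ∈ Finset.range n, simplexDist (z i) (z (i + 1))
    set b := simplexDist (z n) (z (n + 1)) with hb
    have htop := hz.trans ENNReal.coe_lt_top
    lift a to ℝ≥0 using (lt_of_le_of_lt le_self_add htop).ne with a' ha'
    lift b to ℝ≥0 using (lt_of_le_of_lt le_add_self htop).ne with b' hb'
    rw [← ENNReal.coe_add, ENNReal.coe_lt_coe] at hz
    obtain ⟨c, hc, rfl⟩ : ∃ c, 0 < c ∧ L = a' + c + (b' + c) := by
      refine ⟨(L - (a' + b')) / 2, by simpa using hz, ?_⟩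
      have := add_tsub_cancel_of_le hz.le
      rw [add_add_add_comm, add_halves, this]
    obtain ⟨γ, hγ, h0, h1⟩ := ih (L := a' + c) (by
      rw [ENNReal.coe_lt_coe]; exact lt_add_of_pos_right _ hc)
    obtain ⟨γ', hγ', h0', h1'⟩ := exists_curve_of_simplexDist_le (L := b' + c)
      (add_pos_of_nonneg_of_pos zero_le hc).ne' (by
        rw [← hb, ENNReal.coe_le_coe]; exact le_self_add)
    obtain ⟨η, hη, e0, e1⟩ := exists_curve_trans hγ hγ' (b' + c) (h1.trans h0'.symm)
    exact ⟨η, hη, e0.trans h0, e1.trans h1'⟩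

end DavisRealisation

end WeylBuilding

end Curves

/-! ### Closed chambers and compactness -/

section Topology

variable {S W : Type*} [Fintype S] [Group W] {M : CoxeterMatrix S} {cs : CoxeterSystem M W}
  {Ch : Type*} {X : WeylBuilding cs Ch} {ρ : S → ℝ}

namespace WeylBuilding

variable (X) in
/-- A spherical residue of type `J`, given by one of its chambers. -/
def sphericalResidue (J : Finset S) (hJ : cs.IsSpherical (J : Set S)) (C : Ch) :
    X.SphericalResidue :=
  ⟨J, X.residue (J : Set S) C, hJ, C, rfl⟩

/-- A vertex of the Davis realisation. -/
noncomputable def SphericalResidue.vertex (ρ : S → ℝ) (R : X.SphericalResidue) :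
    X.DavisRealisation ρ where
  weight := Finsupp.single R 1
  nonneg R' := by
    classical
    rw [Finsupp.single_apply]
    split_ifs
    exacts [zero_le_one, le_rfl]
  sum_eq_one := by simp
  isChain := by
    rw [Finsupp.support_single _ one_ne_zero, Finset.coe_singleton]
    exact IsChain.singleton

omit [Fintype S] in
theorem SphericalResidue.support_vertex (R : X.SphericalResidue) :
    (R.vertex ρ).weight.support = {R} :=
  Finsupp.support_single _ one_ne_zero

omit [Fintype S] in
theorem SphericalResidue.vertex_mem_chamberRealisation {R : X.SphericalResidue} {C : Ch}
    (h : C ∈ R.carrier) : R.vertex ρ ∈ X.chamberRealisation ρ C := by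
  intro R' hR'
  rw [R.support_vertex, Finset.mem_singleton] at hR'
  rwa [hR']

variable (X) (ρ) in
/-- The centre of a closed chamber: the vertex that is given by the chamber itself. -/
noncomputable def centre (C : Ch) : X.DavisRealisation ρ :=
  (X.sphericalResidue ∅ cs.isSpherical_empty C).vertex ρ

omit [Fintype S] in
theorem centre_mem_chamberRealisation (C : Ch) : X.centre ρ C ∈ X.chamberRealisation ρ C :=
  SphericalResidue.vertex_mem_chamberRealisation (mem_residue_self _ C)

omit [Fintype S] in
theorem eq_of_centre_mem_chamberRealisation {C D : Ch}
    (h : X.centre ρ C ∈ X.chamberRealisation ρ D) : C = D := by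
  have := h (X.sphericalResidue ∅ cs.isSpherical_empty C)
    (by rw [centre, SphericalResidue.support_vertex]; exact Finset.mem_singleton_self _)
  have h1 : X.δ C D ∈ cs.parabolic ((∅ : Finset S) : Set S) := this
  rw [CoxeterSystem.parabolic, Finset.coe_empty, Set.image_empty, Subgroup.closure_empty,
    Subgroup.mem_bot] at h1
  exact (X.eq_one_iff C D).1 h1

omit [Fintype S] in
theorem DavisRealisation.inCommonSimplex_centre {C : Ch} {x : X.DavisRealisation ρ}
    (hx : x ∈ X.chamberRealisation ρ C) : x.InCommonSimplex (X.centre ρ C) := by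
  rw [DavisRealisation.InCommonSimplex, centre, SphericalResidue.support_vertex,
    Finset.coe_singleton, Set.union_singleton]
  refine x.isChain.insert fun R hR _ => Or.inl ?_
  intro D hD
  have h1 : X.δ C D ∈ cs.parabolic ((∅ : Finset S) : Set S) := hD
  rw [SphericalResidue.carrier_eq (hx R (Finset.mem_coe.1 hR))]
  exact cs.parabolic_mono (by simp) h1

theorem joinedIn_centre {C : Ch} {x : X.DavisRealisation ρ}
    (hx : x ∈ X.chamberRealisation ρ C) :
    JoinedIn (X.chamberRealisation ρ C) x (X.centre ρ C) :=
  DavisRealisation.joinedIn_chamberRealisation_of_inCommonSimplex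
    (DavisRealisation.inCommonSimplex_centre hx) hx (centre_mem_chamberRealisation C)

omit [Fintype S] in
/-- The closed chambers at a point are given by the chambers of the least residue in the support. -/
theorem DavisRealisation.exists_min_residue (x : X.DavisRealisation ρ) :
    ∃ R ∈ x.weight.support, ∀ C, C ∈ R.carrier ↔ x ∈ X.chamberRealisation ρ C := by
  have hne : x.weight.support.Nonempty := by
    rw [Finset.nonempty_iff_ne_empty, Ne, Finsupp.support_eq_empty]
    intro h
    have := x.sum_eq_one
    simp [h] at this
  obtain ⟨R, hR, hmin⟩ := Finset.exists_minimalFor (fun R : X.SphericalResidue => R.carrier) _ hne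
  refine ⟨R, hR, fun C => ⟨fun hC R' hR' => ?_, fun h => h R hR⟩⟩
  rcases eq_or_ne R R' with rfl | hne
  · exact hC
  · rcases x.isChain hR hR' hne with h | h
    · exact h hC
    · exact hmin hR' h hC

omit [Fintype S] in
theorem DavisRealisation.exists_mem_chamberRealisation (x : X.DavisRealisation ρ) :
    ∃ C, x ∈ X.chamberRealisation ρ C := by
  obtain ⟨R, -, hR⟩ := x.exists_min_residue
  obtain ⟨C, hC⟩ := R.carrier_nonempty
  exact ⟨C, (hR C).1 hC⟩

omit [Fintype S] in
theorem mem_apartmentRealisation {A : Set Ch} {x : X.DavisRealisation ρ} :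
    x ∈ X.apartmentRealisation ρ A ↔ ∃ C ∈ A, x ∈ X.chamberRealisation ρ C := by
  simp [apartmentRealisation]

omit [Fintype S] in
theorem apartmentRealisation_mono {A B : Set Ch} (h : A ⊆ B) :
    X.apartmentRealisation ρ A ⊆ X.apartmentRealisation ρ B :=
  Set.biUnion_subset_biUnion_left h

omit [Fintype S] in
theorem chamberRealisation_subset {A : Set Ch} {C : Ch} (h : C ∈ A) :
    X.chamberRealisation ρ C ⊆ X.apartmentRealisation ρ A :=
  Set.subset_biUnion_of_mem (u := fun C => X.chamberRealisation ρ C) h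

/-- A union of closed chambers is closed: nearby points have larger supports. -/
theorem isClosed_apartmentRealisation (hρ : ∀ s, 0 < ρ s) (A : Set Ch) :
    IsClosed (X.apartmentRealisation ρ A) := by
  obtain ⟨L, -, hL⟩ := DavisRealisation.exists_lipschitzWith_weight X hρ
  rw [← isOpen_compl_iff, isOpen_iff_mem_nhds]
  intro x hx
  have h1 : ∀ᶠ y in nhds x, ∀ R ∈ x.weight.support, 0 < y.weight R := by
    rw [Filter.eventually_all_finset]
    intro R hR
    refine (hL R).continuous.continuousAt.eventually (lt_mem_nhds ?_)
    exact lt_of_le_of_ne (x.nonneg R) (Finsupp.mem_support_iff.1 hR).symm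
  filter_upwards [h1] with y hy hyA
  obtain ⟨C, hC, hyC⟩ := mem_apartmentRealisation.1 hyA
  exact hx (mem_apartmentRealisation.2
    ⟨C, hC, fun R hR => hyC R (Finsupp.mem_support_iff.2 (hy R hR).ne')⟩)

/-- Sufficiently close points lie in closed chambers of a common spherical residue. -/
theorem exists_edist_bound (hρ : ∀ s, 0 < ρ s) :
    ∃ ε : ℝ≥0, 0 < ε ∧ ∀ x y : X.DavisRealisation ρ, edist x y < ε →
      ∀ C D, x ∈ X.chamberRealisation ρ C → y ∈ X.chamberRealisation ρ D →
        ∃ J : Finset S, cs.IsSpherical (J : Set S) ∧ X.δ C D ∈ cs.parabolic (J : Set S) := by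
  classical
  obtain ⟨L, hL0, hL⟩ := DavisRealisation.exists_lipschitzWith_weight X hρ
  set N : ℕ := Fintype.card (Finset S) with hN
  have hN0 : 0 < N := Fintype.card_pos
  -- A support has at most `N` elements, so some coordinate of `x` is at least `1 / N`.
  refine ⟨(N : ℝ≥0)⁻¹ / L, by positivity, fun x y hxy C D hC hD => ?_⟩
  have hcard : x.weight.support.card ≤ N := by
    refine Finset.card_le_card_of_injOn (t := Finset.univ) SphericalResidue.type (by simp) ?_
    intro R hR R' hR' e
    exact SphericalResidue.ext_of_mem e (hC R hR) (hC R' hR')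
  obtain ⟨R, hR, hRw⟩ : ∃ R ∈ x.weight.support, (N : ℝ)⁻¹ ≤ x.weight R := by
    refine Finset.exists_le_of_sum_le (x.exists_min_residue.imp fun _ h => h.1) ?_
    rw [Finset.sum_const, nsmul_eq_mul, x.sum_weight subset_rfl, ← div_eq_mul_inv]
    exact div_le_one_of_le₀ (by exact_mod_cast hcard) (by positivity)
  have hRy : R ∈ y.weight.support := by
    rw [Finsupp.mem_support_iff]
    intro h0
    have h1 := hL R x y
    simp only [h0, edist_dist, Real.dist_eq, sub_zero, abs_of_nonneg (x.nonneg R)] at h1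
    have h2 : ENNReal.ofReal (x.weight R) < ((N : ℝ≥0)⁻¹ : ℝ≥0) := by
      refine h1.trans_lt ?_
      calc (L : ℝ≥0∞) * edist x y < L * ((N : ℝ≥0)⁻¹ / L : ℝ≥0) :=
            ENNReal.mul_lt_mul_right (by simpa using hL0) ENNReal.coe_ne_top hxy
        _ = _ := by rw [← ENNReal.coe_mul, mul_div_cancel₀ _ hL0]
    rw [← ENNReal.ofReal_coe_nnreal, ENNReal.ofReal_lt_ofReal_iff_of_nonneg (x.nonneg R)] at h2
    push_cast at h2
    linarith
  exact ⟨R.type, R.isSpherical, SphericalResidue.δ_mem (hC R hR) (hD R hRy)⟩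

variable (X) in
/-- The chambers that lie in a spherical residue with a chamber of `F`. -/
def sphericalNeighbours (F : Set Ch) : Set Ch :=
  {D | ∃ C ∈ F, ∃ J : Finset S, cs.IsSpherical (J : Set S) ∧ X.δ C D ∈ cs.parabolic (J : Set S)}

theorem IsLocallyFinite.finite_sphericalNeighbours (hX : X.IsLocallyFinite) {F : Set Ch}
    (hF : F.Finite) : (X.sphericalNeighbours F).Finite := by
  refine (hF.biUnion fun C _ => hX.finite_δ_mem C cs.finite_setOf_spherical).subset ?_
  rintro D ⟨C, hC, J, hJ, h⟩
  exact Set.mem_biUnion hC ⟨J, hJ, h⟩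

omit [Fintype S] in
theorem mem_sphericalNeighbours {F : Set Ch} {C D : Ch} {x : X.DavisRealisation ρ} (hC : C ∈ F)
    (hxC : x ∈ X.chamberRealisation ρ C) (hxD : x ∈ X.chamberRealisation ρ D) :
    D ∈ X.sphericalNeighbours F := by
  obtain ⟨R, -, hR⟩ := x.exists_min_residue
  exact ⟨C, hC, R.type, R.isSpherical, SphericalResidue.δ_mem ((hR C).2 hxC) ((hR D).2 hxD)⟩

theorem exists_finite_of_isCompact (hX : X.IsLocallyFinite) (hρ : ∀ s, 0 < ρ s)
    {K : Set (X.DavisRealisation ρ)} (hK : IsCompact K) :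
    ∃ F : Set Ch, F.Finite ∧ K ⊆ X.apartmentRealisation ρ F := by
  obtain ⟨ε, hε, hεX⟩ := exists_edist_bound (X := X) hρ
  refine hK.induction_on (p := fun K => ∃ F : Set Ch, F.Finite ∧ K ⊆ X.apartmentRealisation ρ F)
    ⟨∅, Set.finite_empty, by simp⟩ ?_ ?_ ?_
  · rintro s t hst ⟨F, hF, h⟩
    exact ⟨F, hF, hst.trans h⟩
  · rintro s t ⟨F, hF, h⟩ ⟨F', hF', h'⟩
    exact ⟨F ∪ F', hF.union hF', Set.union_subset
      (h.trans (apartmentRealisation_mono Set.subset_union_left))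
      (h'.trans (apartmentRealisation_mono Set.subset_union_right))⟩
  · intro x _
    obtain ⟨C, hC⟩ := x.exists_mem_chamberRealisation
    refine ⟨Metric.eball x ε, mem_nhdsWithin_of_mem_nhds
      (Metric.eball_mem_nhds x (by exact_mod_cast hε)), X.sphericalNeighbours {C},
      hX.finite_sphericalNeighbours (Set.finite_singleton C), fun y hy => ?_⟩
    obtain ⟨D, hD⟩ := y.exists_mem_chamberRealisation
    refine mem_apartmentRealisation.2 ⟨D, ⟨C, rfl, hεX x y ?_ C D hC hD⟩, hD⟩
    rwa [Metric.mem_eball'] at hy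

/-- Bounded sets meet only finitely many closed chambers. -/
theorem exists_finite_of_edist_lt (hX : X.IsLocallyFinite) (hρ : ∀ s, 0 < ρ s)
    (x : X.DavisRealisation ρ) (r : ℝ≥0) :
    ∃ F : Set Ch, F.Finite ∧ {y | edist x y < r} ⊆ X.apartmentRealisation ρ F := by
  obtain ⟨ε, hε, hεX⟩ := exists_edist_bound (X := X) hρ
  have key : ∀ k : ℕ, ∃ F : Set Ch, F.Finite ∧
      {y | edist x y < ((k + 1) * ε : ℝ≥0)} ⊆ X.apartmentRealisation ρ F := by
    intro k
    induction k with
    | zero =>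
      obtain ⟨C, hC⟩ := x.exists_mem_chamberRealisation
      refine ⟨X.sphericalNeighbours {C},
        hX.finite_sphericalNeighbours (Set.finite_singleton C), fun y hy => ?_⟩
      obtain ⟨D, hD⟩ := y.exists_mem_chamberRealisation
      refine mem_apartmentRealisation.2 ⟨D, ⟨C, rfl, hεX x y ?_ C D hC hD⟩, hD⟩
      simpa using hy
    | succ k ih =>
      obtain ⟨F, hF, hsub⟩ := ih
      refine ⟨X.sphericalNeighbours F, hX.finite_sphericalNeighbours hF, fun y hy => ?_⟩
      obtain ⟨l, hl, hl'⟩ := ENNReal.lt_iff_exists_nnreal_btwn.1 (Set.mem_ofPred.1 hy)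
      obtain ⟨γ, hγ, h0, h1⟩ := DavisRealisation.exists_curve hl
      rw [ENNReal.coe_lt_coe] at hl'
      -- Go back along the curve from its end by slightly less than `ε`.
      have hk : (0 : ℝ) < k + 2 := by positivity
      have hl'' : (l : ℝ) < (k + 2) * ε := by
        have : (l : ℝ) < ((k + 1 : ℕ) + 1) * ε := by exact_mod_cast hl'
        push_cast at this
        linarith
      set t : ℝ≥0 := (k + 1) / (k + 2) * l with ht
      have ht' : (t : ℝ) = (k + 1) / (k + 2) * l := by rw [ht]; push_cast; rfl
      have htl : (t : ℝ) + l / (k + 2) = l := by rw [ht']; field_simp; ring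
      have h3 : (l : ℝ) / (k + 2) < ε := by rw [div_lt_iff₀ hk]; linarith
      have h4 : (t : ℝ) < (k + 1) * ε := by
        rw [ht', div_mul_eq_mul_div, div_lt_iff₀ hk, mul_assoc]
        have : (0 : ℝ) < k + 1 := by positivity
        nlinarith
      have e1 : edist x (γ t) < ((k + 1) * ε : ℝ≥0) := by
        have := hγ 0 t
        rw [h0, ENNReal.coe_one, one_mul, edist_nndist, NNReal.nndist_eq, zero_tsub,
          max_eq_right zero_le, tsub_zero] at this
        refine this.trans_lt (ENNReal.coe_lt_coe.2 ?_)
        exact_mod_cast h4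
      have e2 : edist (γ t) y < ε := by
        have := hγ t l
        rw [h1, ENNReal.coe_one, one_mul, edist_dist, NNReal.dist_eq, abs_sub_comm,
          abs_of_nonneg (by rw [← htl, add_sub_cancel_left]; positivity)] at this
        refine this.trans_lt ?_
        rw [← ENNReal.ofReal_coe_nnreal, ENNReal.ofReal_lt_ofReal_iff (by exact_mod_cast hε)]
        linarith
      obtain ⟨C, hCF, hC⟩ := mem_apartmentRealisation.1 (hsub e1)
      obtain ⟨D, hD⟩ := y.exists_mem_chamberRealisation
      exact mem_apartmentRealisation.2 ⟨D, ⟨C, hCF, hεX _ y e2 C D hC hD⟩, hD⟩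
  obtain ⟨k, hk⟩ := exists_nat_gt (r / ε)
  obtain ⟨F, hF, h⟩ := key k
  refine ⟨F, hF, fun y hy => h (lt_of_lt_of_le (Set.mem_ofPred.1 hy) (ENNReal.coe_le_coe.2 ?_))⟩
  rw [div_lt_iff₀ hε] at hk
  exact hk.le.trans (by gcongr; exact le_self_add)

theorem edist_ne_top (x y : X.DavisRealisation ρ) : edist x y ≠ ⊤ := by
  have h1 : ∀ {x y : X.DavisRealisation ρ}, x.InCommonSimplex y → edist x y ≠ ⊤ := fun h =>
    ((DavisRealisation.edist_le_simplexDist _ _).trans_lt (by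
      rw [DavisRealisation.simplexDist_of_inCommonSimplex h]; exact ENNReal.ofReal_lt_top)).ne
  have htri : ∀ {x y z : X.DavisRealisation ρ}, edist x y ≠ ⊤ → edist y z ≠ ⊤ → edist x z ≠ ⊤ :=
    fun h h' => ((edist_triangle _ _ _).trans_lt (ENNReal.add_lt_top.2
      ⟨h.lt_top, h'.lt_top⟩)).ne
  have h2 : ∀ {x y : X.DavisRealisation ρ} {C : Ch}, x ∈ X.chamberRealisation ρ C →
      y ∈ X.chamberRealisation ρ C → edist x y ≠ ⊤ := fun hx hy =>
    htri (h1 (DavisRealisation.inCommonSimplex_centre hx))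
      (by rw [edist_comm]; exact h1 (DavisRealisation.inCommonSimplex_centre hy))
  have h3 : ∀ (ω : List S) (C D : Ch), X.IsGallery ω C D →
      edist (X.centre ρ C) (X.centre ρ D) ≠ ⊤ := by
    intro ω
    induction ω with
    | nil => rintro C _ rfl; simp
    | cons s ω ih =>
      rintro C D ⟨C', hC', h⟩
      refine htri ?_ (ih C' D h)
      let P := X.sphericalResidue {s} (cs.isSpherical_singleton s) C
      have hP : P.vertex ρ ∈ X.chamberRealisation ρ C' := by
        refine SphericalResidue.vertex_mem_chamberRealisation ?_
        change X.δ C C' ∈ cs.parabolic _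
        rw [hC']
        exact cs.simple_mem_parabolic (by simp)
      exact htri (h2 (centre_mem_chamberRealisation C)
        (SphericalResidue.vertex_mem_chamberRealisation (mem_residue_self _ C)))
        (h2 hP (centre_mem_chamberRealisation C'))
  obtain ⟨C, hC⟩ := x.exists_mem_chamberRealisation
  obtain ⟨D, hD⟩ := y.exists_mem_chamberRealisation
  obtain ⟨ω, hω⟩ := cs.wordProd_surjective (X.δ C D)
  exact htri (htri (h2 hC (centre_mem_chamberRealisation C))
    (h3 ω C D (X.isGallery_of_δ_eq hω.symm))) (h2 (centre_mem_chamberRealisation D) hD)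

/-- The closed simplex with the given vertices, as a subset of the Davis realisation, is
compact. -/
theorem isCompact_setOf_support_subset {K : Finset X.SphericalResidue}
    (hK : IsChain (fun R R' : X.SphericalResidue => R.carrier ⊆ R'.carrier)
      (K : Set X.SphericalResidue)) :
    IsCompact {x : X.DavisRealisation ρ | x.weight.support ⊆ K} := by
  classical
  let w : (K → ℝ) → X.SphericalResidue →₀ ℝ := fun a =>
    Finsupp.onFinset K (fun R => if h : R ∈ K then a ⟨R, h⟩ else 0) fun R hR => by
      by_contra h; simp [h] at hR
  have hw : ∀ a, (w a).support ⊆ K := fun a => Finsupp.support_onFinset_subset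
  have hwa : ∀ a (R : K), w a R = a R := fun a R => by simp [w]
  let f : stdSimplex ℝ K → X.DavisRealisation ρ := fun a =>
    { weight := w a
      nonneg := fun R => by
        by_cases h : R ∈ K
        · rw [hwa a ⟨R, h⟩]; exact a.2.1 _
        · simp [w, h]
      sum_eq_one := by
        rw [Finsupp.sum_of_support_subset _ (hw _) _ (by simp), ← Finset.sum_coe_sort, ← a.2.2]
        exact Finset.sum_congr rfl fun R _ => hwa _ R
      isChain := hK.mono (by exact_mod_cast hw _) }
  have hpos : Continuous fun a => (f a).position := by
    have : (fun a => (f a).position) = fun a : stdSimplex ℝ K =>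
        ∑ R : K, (a : K → ℝ) R • M.vertexVector ρ R.1.type := by
      ext1 a
      rw [(f a).position_eq_sum (hw _), ← Finset.sum_coe_sort]
      exact Finset.sum_congr rfl fun R _ => by rw [← hwa a R]
    rw [this]
    exact continuous_finsetSum _ fun R _ =>
      ((continuous_apply R).comp continuous_subtype_val).smul continuous_const
  have hcont : Continuous f := by
    rw [continuous_iff_continuousAt]
    intro b
    rw [ContinuousAt, tendsto_iff_edist_tendsto_0]
    have hcs : ∀ a, (f a).InCommonSimplex (f b) := fun a =>
      hK.mono (Set.union_subset (by exact_mod_cast hw _) (by exact_mod_cast hw _))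
    have hlim : Filter.Tendsto (fun a => ENNReal.ofReal (√(((f a).position - (f b).position) ⬝ᵥ
        M.cosineMatrix.mulVec ((f a).position - (f b).position)))) (nhds b) (nhds 0) := by
      have hc : Continuous fun a => ENNReal.ofReal (√(((f a).position - (f b).position) ⬝ᵥ
          M.cosineMatrix.mulVec ((f a).position - (f b).position))) := by
        have h1 : Continuous fun a => (f a).position - (f b).position := hpos.sub continuous_const
        exact ENNReal.continuous_ofReal.comp (Real.continuous_sqrt.comp
          (h1.dotProduct (continuous_const.matrix_mulVec h1)))
      have := hc.tendsto b
      simpa using this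
    refine tendsto_of_tendsto_of_tendsto_of_le_of_le tendsto_const_nhds hlim (fun _ => zero_le)
      fun a => ?_
    rw [← DavisRealisation.simplexDist_of_inCommonSimplex (hcs a)]
    exact DavisRealisation.edist_le_simplexDist _ _
  convert isCompact_range hcont
  ext x
  constructor
  · intro hx
    refine ⟨⟨fun R => x.weight R, fun R => x.nonneg R, ?_⟩, DavisRealisation.ext_weight ?_⟩
    · rw [← x.sum_weight hx, ← Finset.sum_coe_sort K]
    · ext R
      by_cases h : R ∈ K
      · exact hwa _ ⟨R, h⟩
      · rw [Finsupp.notMem_support_iff.1 fun h' => h (hx h')]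
        simp [f, w, h]
  · rintro ⟨a, rfl⟩
    exact hw _

theorem isCompact_chamberRealisation (C : Ch) : IsCompact (X.chamberRealisation ρ C) := by
  classical
  have hfin : {R : X.SphericalResidue | C ∈ R.carrier}.Finite :=
    Set.Finite.of_injOn (f := SphericalResidue.type) (t := Set.univ) (fun _ _ => Set.mem_univ _)
      (fun R hR R' hR' e => SphericalResidue.ext_of_mem e hR hR') (Set.toFinite _)
  have : X.chamberRealisation ρ C = ⋃ K ∈ hfin.toFinset.powerset.filter fun K : Finset X.SphericalResidue =>
      IsChain (fun R R' : X.SphericalResidue => R.carrier ⊆ R'.carrier)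
        (K : Set X.SphericalResidue), {x : X.DavisRealisation ρ | x.weight.support ⊆ K} := by
    ext x
    simp only [Set.mem_iUnion, Finset.mem_filter, Finset.mem_powerset, exists_prop]
    constructor
    · exact fun hx => ⟨x.weight.support, ⟨fun R hR => hfin.mem_toFinset.2 (hx R hR), x.isChain⟩,
        Finset.Subset.refl x.weight.support⟩
    · rintro ⟨K, ⟨hK, -⟩, hx⟩ R hR
      exact hfin.mem_toFinset.1 (hK (hx hR))
  rw [this]
  exact Finset.isCompact_biUnion _ fun K hK =>
    isCompact_setOf_support_subset (Finset.mem_filter.1 hK).2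

theorem isCompact_apartmentRealisation {F : Set Ch} (hF : F.Finite) :
    IsCompact (X.apartmentRealisation ρ F) :=
  hF.isCompact_biUnion fun C _ => isCompact_chamberRealisation C

end WeylBuilding

end Topology

/-! ### Galleries that avoid a finite set of chambers -/

section Components

variable {S W : Type*} [Group W] {M : CoxeterMatrix S} {cs : CoxeterSystem M W}
  {Ch : Type*} {X : WeylBuilding cs Ch}

namespace WeylBuilding

variable (X) in
/-- Two chambers can be joined by a gallery that avoids `F`. The gallery of length zero is always
allowed, even for a chamber in `F`. -/
def JoinedOutside (F : Set Ch) : Ch → Ch → Prop :=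
  Relation.ReflTransGen fun C D => C ∉ F ∧ D ∉ F ∧ ∃ s, X.δ C D = cs.simple s

variable (X) in
/-- Combinatorial one-endedness: the chambers outside a suitable finite set are joined to each other
by galleries that avoid a given finite set. -/
def IsGalleryOneEnded : Prop :=
  ∀ F : Set Ch, F.Finite → ∃ F' : Set Ch, F'.Finite ∧ ∀ C ∉ F', ∀ D ∉ F', X.JoinedOutside F C D

variable (X) in
/-- A set of chambers is a union of components of the complement of `F`. -/
def IsClosedOutside (F K : Set Ch) : Prop :=
  ∀ C ∈ K, ∀ D ∉ F, ∀ s, X.δ C D = cs.simple s → D ∈ K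

theorem JoinedOutside.symm {F : Set Ch} {C D : Ch} (h : X.JoinedOutside F C D) :
    X.JoinedOutside F D C := by
  induction h with
  | refl => exact Relation.ReflTransGen.refl
  | tail _ h ih =>
    obtain ⟨h1, h2, s, hs⟩ := h
    exact Relation.ReflTransGen.head ⟨h2, h1, s, X.δ_eq_simple_symm hs⟩ ih

theorem JoinedOutside.mono {F F' : Set Ch} (hF : F ⊆ F') {C D : Ch}
    (h : X.JoinedOutside F' C D) : X.JoinedOutside F C D :=
  Relation.ReflTransGen.mono (fun _ _ ⟨h1, h2, h3⟩ => ⟨fun h => h1 (hF h), fun h => h2 (hF h), h3⟩)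
    _ _ h

theorem JoinedOutside.notMem {F : Set Ch} {C D : Ch} (h : X.JoinedOutside F C D) (hC : C ∉ F) :
    D ∉ F := by
  rcases Relation.ReflTransGen.cases_tail h with h | ⟨E, -, -, h, -⟩
  · rwa [h]
  · exact h

theorem isClosedOutside_setOf_joinedOutside {F : Set Ch} {C : Ch} (hC : C ∉ F) :
    X.IsClosedOutside F {D | X.JoinedOutside F C D} :=
  fun _ hD _ hE s hs => Relation.ReflTransGen.tail hD ⟨JoinedOutside.notMem hD hC, hE, s, hs⟩

/-- All but finitely many chambers lie in infinite components of the complement of a finite set,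
because every component has a chamber in the finite boundary of that set. -/
theorem IsLocallyFinite.finite_setOf_finite_component [Finite S] (hX : X.IsLocallyFinite)
    {F : Set Ch} (hF : F.Finite) (hne : F.Nonempty) :
    {C | C ∉ F ∧ {D | X.JoinedOutside F C D}.Finite}.Finite := by
  obtain ⟨E, hE⟩ := hne
  have hbd : {D | ∃ C ∈ F, ∃ s, X.δ C D = cs.simple s}.Finite := by
    refine (hF.biUnion fun C _ => hX.finite_δ_mem C (cs.finite_setOf_length_le 1)).subset ?_
    rintro D ⟨C, hC, s, hs⟩
    exact Set.mem_biUnion hC (by simp [hs])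
  -- A gallery to a chamber of `F` passes through the boundary before it enters `F`.
  have hexit : ∀ (ω : List S) (C : Ch), X.IsGallery ω C E → C ∉ F →
      ∃ D, X.JoinedOutside F C D ∧ D ∈ {D | ∃ C ∈ F, ∃ s, X.δ C D = cs.simple s} := by
    intro ω
    induction ω with
    | nil => rintro C rfl hC; exact absurd hE hC
    | cons s ω ih =>
      rintro C ⟨C', hC', h⟩ hC
      by_cases hC'F : C' ∈ F
      · exact ⟨C, Relation.ReflTransGen.refl, C', hC'F, s, X.δ_eq_simple_symm hC'⟩
      · obtain ⟨D, hD, hD'⟩ := ih C' h hC'F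
        exact ⟨D, Relation.ReflTransGen.head ⟨hC, hC'F, s, hC'⟩ hD, hD'⟩
  refine ((hbd.inter_of_left {D | {D' | X.JoinedOutside F D D'}.Finite}).biUnion
    (t := fun D => {D' | X.JoinedOutside F D D'}) fun D hD => hD.2).subset ?_
  rintro C ⟨hC, hfin⟩
  obtain ⟨ω, hω⟩ := cs.wordProd_surjective (X.δ C E)
  obtain ⟨D, hD, hD'⟩ := hexit ω C (X.isGallery_of_δ_eq hω.symm) hC
  exact Set.mem_biUnion (x := D) ⟨hD', hfin.subset fun D' h => hD.trans h⟩ hD.symm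

theorem joinedOutside_empty (C D : Ch) : X.JoinedOutside ∅ C D := by
  obtain ⟨ω, hω⟩ := cs.wordProd_surjective (X.δ C D)
  have := X.isGallery_of_δ_eq hω.symm
  clear hω
  induction ω generalizing C with
  | nil => obtain rfl : C = D := this; exact Relation.ReflTransGen.refl
  | cons s ω ih =>
    obtain ⟨C', h1, h2⟩ := this
    exact Relation.ReflTransGen.head ⟨by simp, by simp, s, h1⟩ (ih C' h2)

theorem JoinedOutside.map {α : W → Ch} (hα : ∀ v w, X.δ (α v) (α w) = v⁻¹ * w) {F : Set W}
    {F' : Set Ch} (hF : ∀ w, α w ∈ F' → w ∈ F) {v w : W} (h : (thin cs).JoinedOutside F v w) :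
    X.JoinedOutside F' (α v) (α w) := by
  induction h with
  | refl => exact Relation.ReflTransGen.refl
  | tail _ h ih =>
    obtain ⟨h1, h2, s, hs⟩ := h
    exact Relation.ReflTransGen.tail ih
      ⟨fun h => h1 (hF _ h), fun h => h2 (hF _ h), s, by rw [hα]; exact hs⟩

/-- One-endedness passes from the Coxeter complex to the building: two chambers far away from a
ball lie in a common apartment, and the ball meets that apartment in a set of bounded diameter. -/
theorem isGalleryOneEnded_of_thin [Finite S] (hX : X.IsLocallyFinite) {𝒜 : Set (Set Ch)}
    (h𝒜 : X.IsApartmentSystem 𝒜) (h : (thin cs).IsGalleryOneEnded) : X.IsGalleryOneEnded := by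
  intro F hF
  obtain ⟨c⟩ := X.nonempty
  obtain ⟨n, hn⟩ := (hF.image fun C => cs.length (X.δ c C)).bddAbove
  obtain ⟨F', hF', hjoin⟩ := h _ (cs.finite_setOf_length_le (2 * n))
  obtain ⟨m, hm⟩ := (hF'.image cs.length).bddAbove
  refine ⟨{C | X.δ c C ∈ {w | cs.length w ≤ n + m}},
    hX.finite_δ_mem c (cs.finite_setOf_length_le _), fun C hC D hD => ?_⟩
  obtain ⟨A, hA, hCA, hDA⟩ := h𝒜.2 C D
  obtain ⟨α, hα, rfl⟩ := h𝒜.1 A hA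
  obtain ⟨v, rfl⟩ := hCA
  obtain ⟨w, rfl⟩ := hDA
  by_cases hu : ∃ u, α u ∈ F
  · obtain ⟨u, hu⟩ := hu
    have hu' : cs.length (X.δ c (α u)) ≤ n := hn ⟨_, hu, rfl⟩
    have hα' : ∀ v w, X.δ (α (u * v)) (α (u * w)) = v⁻¹ * w := fun v w => by rw [hα]; group
    have hfar : ∀ v, α v ∉ {C | X.δ c C ∈ {w | cs.length w ≤ n + m}} → u⁻¹ * v ∉ F' := by
      intro v hv hv'
      have h1 : cs.length (u⁻¹ * v) ≤ m := hm ⟨_, hv', rfl⟩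
      have h2 := X.length_δ_triangle c (α u) (α v)
      rw [hα u v] at h2
      exact hv (show cs.length _ ≤ _ by omega)
    have := (hjoin _ (hfar v hC) _ (hfar w hD)).map hα' (F' := F) fun x hx => by
      have h1 : cs.length (X.δ c (α (u * x))) ≤ n := hn ⟨_, hx, rfl⟩
      have h2 := X.length_δ_triangle (α u) c (α (u * x))
      rw [hα, inv_mul_cancel_left, X.length_δ_comm (α u) c] at h2
      change cs.length x ≤ 2 * n
      omega
    simpa using this
  · exact (joinedOutside_empty v w).map hα fun x hx => (hu ⟨x, hx⟩).elim

end WeylBuilding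

end Components

/-! ### Ends of the Davis realisation -/

section Ends

variable {S W : Type*} [Fintype S] [Group W] {M : CoxeterMatrix S} {cs : CoxeterSystem M W}
  {Ch : Type*} {X : WeylBuilding cs Ch} {ρ : S → ℝ}

namespace WeylBuilding

omit [Fintype S] in
/-- Unions of components of the complement of `F` are separated from each other outside the closed
chambers of `F`: the closed chambers at a point form a residue, which is gallery-connected. -/
theorem IsClosedOutside.mem_of_mem_chamberRealisation {F K : Set Ch} (hK : X.IsClosedOutside F K)
    {x : X.DavisRealisation ρ} (hx : x ∉ X.apartmentRealisation ρ F) {C D : Ch} (hC : C ∈ K)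
    (hxC : x ∈ X.chamberRealisation ρ C) (hxD : x ∈ X.chamberRealisation ρ D) : D ∈ K := by
  obtain ⟨R, -, hR⟩ := x.exists_min_residue
  obtain ⟨ω, hω, e⟩ := cs.exists_word_of_mem_parabolic
    (SphericalResidue.δ_mem ((hR C).2 hxC) ((hR D).2 hxD))
  have hgal := X.isGallery_of_δ_eq e
  clear e
  induction ω generalizing C with
  | nil => obtain rfl : C = D := hgal; exact hC
  | cons s ω ih =>
    obtain ⟨C', h1, h2⟩ := hgal
    have hC'R : C' ∈ R.carrier := by
      rw [SphericalResidue.carrier_eq ((hR C).2 hxC)]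
      change X.δ C C' ∈ cs.parabolic _
      rw [h1]
      exact cs.simple_mem_parabolic (hω s (by simp))
    have hxC' := (hR C').1 hC'R
    have hC'F : C' ∉ F := fun h => hx (mem_apartmentRealisation.2 ⟨C', h, hxC'⟩)
    exact ih (hK C hC C' hC'F s h1) hxC' (fun t ht => hω t (List.mem_cons_of_mem _ ht)) h2

theorem IsClosedOutside.subset_of_isPreconnected (hρ : ∀ s, 0 < ρ s) {F K : Set Ch}
    (hK : X.IsClosedOutside F K) {P : Set (X.DavisRealisation ρ)} (hP : IsPreconnected P)
    (hPF : P ⊆ (X.apartmentRealisation ρ F)ᶜ) {x : X.DavisRealisation ρ} (hxP : x ∈ P)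
    (hxK : x ∈ X.apartmentRealisation ρ K) : P ⊆ X.apartmentRealisation ρ K := by
  have hdisj : ∀ y ∈ P, y ∈ X.apartmentRealisation ρ K → y ∉ X.apartmentRealisation ρ Kᶜ := by
    intro y hy hyK hyK'
    obtain ⟨C, hC, hyC⟩ := mem_apartmentRealisation.1 hyK
    obtain ⟨D, hD, hyD⟩ := mem_apartmentRealisation.1 hyK'
    exact hD (hK.mem_of_mem_chamberRealisation (hPF hy) hC hyC hyD)
  refine (isPreconnected_iff_subset_of_disjoint_closed.1 hP _ _
    (isClosed_apartmentRealisation hρ K) (isClosed_apartmentRealisation hρ Kᶜ) ?_ ?_).resolve_right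
    fun h => hdisj x hxP hxK (h hxP)
  · intro y _
    obtain ⟨C, hC⟩ := y.exists_mem_chamberRealisation
    by_cases h : C ∈ K
    · exact Or.inl (chamberRealisation_subset h hC)
    · exact Or.inr (chamberRealisation_subset h hC)
  · exact Set.eq_empty_of_forall_notMem fun y ⟨hy, h1, h2⟩ => hdisj y hy h1 h2

theorem exists_edist_le_of_isCompact (x : X.DavisRealisation ρ) {K : Set (X.DavisRealisation ρ)}
    (hK : IsCompact K) : ∃ r : ℝ≥0, ∀ y ∈ K, edist x y ≤ r := by
  rcases K.eq_empty_or_nonempty with rfl | hne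
  · exact ⟨0, by simp⟩
  · obtain ⟨y, -, hy⟩ := hK.exists_isMaxOn (f := fun y => edist x y) hne
      (Continuous.continuousOn (by fun_prop))
    refine ⟨(edist x y).toNNReal, fun z hz => ?_⟩
    rw [ENNReal.coe_toNNReal (edist_ne_top x y)]
    exact hy hz

theorem isProperRay_of_isometry {r : ℝ≥0 → X.DavisRealisation ρ} (hr : Isometry r) :
    IsProperRay r := by
  refine ⟨hr, fun K hK => ?_⟩
  obtain ⟨b, hb⟩ := exists_edist_le_of_isCompact (r 0) hK
  obtain ⟨N, hN⟩ := exists_nat_gt b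
  refine ⟨N, ?_⟩
  rintro _ ⟨t, ht, rfl⟩ hK
  have := hb _ hK
  rw [hr.edist_eq, edist_nndist, NNReal.nndist_eq, zero_tsub, max_eq_right zero_le, tsub_zero,
    ENNReal.coe_le_coe] at this
  exact absurd (hN.trans_le ht) (not_lt.2 this)

/-- An infinite union of components of the complement of a finite set of chambers contains an end of
a geodesic ray. The ray is a limit, along an ultrafilter, of curves of nearly minimal length to
points of the union that are farther and farther away. -/
theorem IsClosedOutside.exists_isProperRay (hX : X.IsLocallyFinite) (hρ : ∀ s, 0 < ρ s)
    {F K : Set Ch} (hF : F.Finite) (hK : X.IsClosedOutside F K) (hKinf : K.Infinite) :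
    ∃ r : ℝ≥0 → X.DavisRealisation ρ, IsProperRay r ∧
      ∃ T : ℝ≥0, ∀ t, T ≤ t → r t ∈ X.apartmentRealisation ρ K := by
  obtain ⟨c⟩ := X.nonempty
  set x := X.centre ρ c
  have hfar : ∀ k : ℕ, ∃ p ∈ X.apartmentRealisation ρ K, (k : ℝ≥0∞) ≤ edist x p := by
    intro k
    obtain ⟨F', hF', hsub⟩ := exists_finite_of_edist_lt hX hρ x k
    obtain ⟨C, hC, hCF'⟩ := hKinf.exists_notMem_finite hF'
    refine ⟨X.centre ρ C, chamberRealisation_subset hC (centre_mem_chamberRealisation C), ?_⟩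
    by_contra h
    obtain ⟨D, hD, hCD⟩ := mem_apartmentRealisation.1 (hsub (by simpa using h))
    exact hCF' (eq_of_centre_mem_chamberRealisation hCD ▸ hD)
  choose p hpK hp using hfar
  let d : ℕ → ℝ≥0 := fun k => (edist x (p k)).toNNReal
  have hd : ∀ k, edist x (p k) = d k := fun k => (ENNReal.coe_toNNReal (edist_ne_top _ _)).symm
  have hkd : ∀ k : ℕ, (k : ℝ≥0) ≤ d k := fun k => by
    have := hp k
    rw [hd] at this
    exact_mod_cast this
  let η : ℕ → ℝ≥0 := fun k => 1 / ((k : ℝ≥0) + 1)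
  have hη0 : ∀ k, 0 < η k := fun k => by positivity
  have hη1 : ∀ k, η k ≤ 1 := fun k => div_le_one_of_le₀ (by simp) zero_le
  have hηlim : Filter.Tendsto η Filter.atTop (nhds 0) := by
    rw [← NNReal.tendsto_coe]
    simpa [η] using tendsto_one_div_add_atTop_nhds_zero_nat (𝕜 := ℝ)
  have hcurve : ∀ k, ∃ γ : ℝ≥0 → X.DavisRealisation ρ, LipschitzWith 1 γ ∧ γ 0 = x ∧
      γ (d k + η k) = p k := fun k => DavisRealisation.exists_curve (by
    rw [hd, ENNReal.coe_lt_coe]; exact lt_add_of_pos_right _ (hη0 k))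
  choose γ hγ hγ0 hγ1 using hcurve
  have hle : ∀ k s t, s ≤ t → edist (γ k s) (γ k t) ≤ (t - s : ℝ≥0) := fun k s t hst => by
    have := hγ k s t
    rwa [ENNReal.coe_one, one_mul, edist_nndist s t, NNReal.nndist_eq,
      tsub_eq_zero_of_le hst, max_eq_right zero_le] at this
  have hge : ∀ k s t, s ≤ t → t ≤ d k + η k → (t : ℝ≥0∞) ≤ s + edist (γ k s) (γ k t) + η k := by
    intro k s t hst ht
    have h1 : (d k : ℝ≥0∞) ≤ s + edist (γ k s) (γ k t) + (d k + η k - t : ℝ≥0) := by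
      rw [← hd k]
      refine (edist_triangle4 x (γ k s) (γ k t) (p k)).trans ?_
      gcongr
      · simpa [hγ0] using hle k 0 s zero_le
      · simpa [hγ1] using hle k t (d k + η k) ht
    have h2 := add_le_add_left h1 (t : ℝ≥0∞)
    rw [add_assoc _ _ (t : ℝ≥0∞), ← ENNReal.coe_add (d k + η k - t), tsub_add_cancel_of_le ht,
      ENNReal.coe_add, add_left_comm] at h2
    exact (ENNReal.add_le_add_iff_left ENNReal.coe_ne_top).1 h2
  let U : Ultrafilter ℕ := Filter.hyperfilter ℕ
  have hU : (U : Filter ℕ) ≤ Filter.atTop := Nat.hyperfilter_le_atTop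
  have hlim : ∀ t : ℝ≥0, ∃ y, Filter.Tendsto (fun k => γ k t) U (nhds y) := by
    intro t
    obtain ⟨F', hF', hsub⟩ := exists_finite_of_edist_lt hX hρ x (t + 1)
    obtain ⟨y, -, hy⟩ := (isCompact_apartmentRealisation (ρ := ρ) hF').ultrafilter_le_nhds
      (U.map fun k => γ k t) (by
        rw [Filter.le_principal_iff]
        refine Filter.mem_map.2 (Filter.univ_mem' fun k => hsub ?_)
        have := hle k 0 t zero_le
        rw [hγ0, tsub_zero] at this
        exact this.trans_lt (ENNReal.coe_lt_coe.2 (lt_add_one t)))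
    exact ⟨y, hy⟩
  choose r hr using hlim
  have hbig : ∀ t : ℝ≥0, ∀ᶠ k in (U : Filter ℕ), t ≤ d k + η k := by
    intro t
    obtain ⟨N, hN⟩ := exists_nat_ge t
    filter_upwards [hU (Filter.eventually_ge_atTop N)] with k hk
    have : (N : ℝ≥0) ≤ k := by exact_mod_cast hk
    exact hN.trans (this.trans ((hkd k).trans le_self_add))
  have hiso : ∀ s t, s ≤ t → edist (r s) (r t) = (t - s : ℝ≥0) := by
    intro s t hst
    have hl := (hr s).edist (hr t)
    refine le_antisymm (le_of_tendsto hl (Filter.Eventually.of_forall fun k => hle k s t hst)) ?_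
    have hl' : Filter.Tendsto (fun k => (s : ℝ≥0∞) + edist (γ k s) (γ k t) + η k) U
        (nhds (s + edist (r s) (r t) + (0 : ℝ≥0))) :=
      (tendsto_const_nhds.add hl).add (ENNReal.tendsto_coe.2 (hηlim.mono_left hU))
    have := ge_of_tendsto hl' ((hbig t).mono fun k hk => hge k s t hst hk)
    rw [ENNReal.coe_zero, add_zero] at this
    rw [ENNReal.coe_sub]
    exact tsub_le_iff_left.2 this
  have hisom : Isometry r := by
    intro s t
    rw [edist_nndist s t, NNReal.nndist_eq]
    rcases le_total s t with hst | hst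
    · rw [hiso s t hst, tsub_eq_zero_of_le hst, max_eq_right zero_le]
    · rw [edist_comm, hiso t s hst, tsub_eq_zero_of_le hst, max_eq_left zero_le]
  obtain ⟨b, hb⟩ := exists_edist_le_of_isCompact x (isCompact_apartmentRealisation (ρ := ρ) hF)
  refine ⟨r, isProperRay_of_isometry hisom, b + 2, fun t ht => ?_⟩
  refine (isClosed_apartmentRealisation hρ K).mem_of_tendsto (hr t) ?_
  filter_upwards [hbig t] with k hk
  -- The part of the `k`-th curve after the time `t` avoids the closed chambers of `F`.
  refine hK.subset_of_isPreconnected hρ (P := γ k '' Set.Icc t (d k + η k))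
    (isPreconnected_Icc.image _ (hγ k).continuous.continuousOn) ?_
    (x := p k) ⟨_, Set.right_mem_Icc.2 hk, hγ1 k⟩ (hpK k) ⟨t, Set.left_mem_Icc.2 hk, rfl⟩
  rintro _ ⟨s, hs, rfl⟩ hsF
  have h1 := hge k 0 s zero_le hs.2
  rw [hγ0, ENNReal.coe_zero, zero_add] at h1
  have h2 : (s : ℝ≥0∞) ≤ (b + 1 : ℝ≥0) := by
    rw [ENNReal.coe_add]
    exact h1.trans (add_le_add (hb _ hsF) (ENNReal.coe_le_coe.2 (hη1 k)))
  have h3 : b + 2 ≤ b + 1 := (ht.trans hs.1).trans (ENNReal.coe_le_coe.1 h2)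
  have h4 : (2 : ℝ≥0) ≤ 1 := le_of_add_le_add_left h3
  norm_num at h4

theorem isGalleryOneEnded_of_isOneEnded (hX : X.IsLocallyFinite) (hρ : ∀ s, 0 < ρ s)
    (h : IsOneEnded (X.DavisRealisation ρ)) : X.IsGalleryOneEnded := by
  intro F₀ hF₀
  obtain ⟨c⟩ := X.nonempty
  -- Only components of the complement of a nonempty set have to meet its boundary.
  set F := insert c F₀
  have hF : F.Finite := hF₀.insert c
  have hbad := hX.finite_setOf_finite_component hF ⟨c, Set.mem_insert c F₀⟩
  refine ⟨F ∪ {C | C ∉ F ∧ {D | X.JoinedOutside F C D}.Finite}, hF.union hbad,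
    fun C hC D hD => JoinedOutside.mono (Set.subset_insert c F₀) ?_⟩
  have hinf : ∀ {C}, C ∉ F ∪ {C | C ∉ F ∧ {D | X.JoinedOutside F C D}.Finite} →
      C ∉ F ∧ {D | X.JoinedOutside F C D}.Infinite := fun {C} hC =>
    ⟨fun h => hC (Or.inl h), fun h => hC (Or.inr ⟨fun h => hC (Or.inl h), h⟩)⟩
  obtain ⟨hCF, hCinf⟩ := hinf hC
  obtain ⟨hDF, hDinf⟩ := hinf hD
  have hKC := isClosedOutside_setOf_joinedOutside (X := X) hCF
  have hKD := isClosedOutside_setOf_joinedOutside (X := X) hDF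
  obtain ⟨r₁, hr₁, T₁, hT₁⟩ := hKC.exists_isProperRay hX hρ hF hCinf
  obtain ⟨r₂, hr₂, T₂, hT₂⟩ := hKD.exists_isProperRay hX hρ hF hDinf
  obtain ⟨N, hN⟩ := h r₁ r₂ hr₁ hr₂ _ (isCompact_apartmentRealisation hF)
  set t := max (N : ℝ≥0) (max T₁ T₂) with ht
  obtain ⟨q, hq⟩ := hN (r₁ t) ⟨t, Set.mem_Ici.2 (le_max_left _ _), rfl⟩ (r₂ t) ⟨t, Set.mem_Ici.2 (le_max_left _ _), rfl⟩
  have h1 := hT₁ t ((le_max_left _ _).trans (le_max_right _ _))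
  have h2 := hT₂ t ((le_max_right _ _).trans (le_max_right _ _))
  have h3 := hKC.subset_of_isPreconnected hρ (P := Set.range q) (isPreconnected_range q.continuous)
    (by rintro _ ⟨u, rfl⟩; exact hq u) ⟨0, q.source⟩ h1 ⟨1, q.target⟩
  obtain ⟨C', hC', hC'x⟩ := mem_apartmentRealisation.1 h3
  obtain ⟨D', hD', hD'x⟩ := mem_apartmentRealisation.1 h2
  have hx : r₂ t ∉ X.apartmentRealisation ρ F := by simpa using hq 1
  have h4 : X.JoinedOutside F C D' := hKC.mem_of_mem_chamberRealisation hx hC' hC'x hD'x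
  exact h4.trans (JoinedOutside.symm hD')

theorem isOneEnded_of_isGalleryOneEnded (hX : X.IsLocallyFinite) (hρ : ∀ s, 0 < ρ s)
    (h : X.IsGalleryOneEnded) : IsOneEnded (X.DavisRealisation ρ) := by
  intro r₁ r₂ hr₁ hr₂ K hK
  obtain ⟨F₀, hF₀, hKF₀⟩ := exists_finite_of_isCompact hX hρ hK
  set F := X.sphericalNeighbours F₀
  have hF : F.Finite := hX.finite_sphericalNeighbours hF₀
  have hchamber : ∀ C ∉ F, X.chamberRealisation ρ C ⊆ Kᶜ := by
    intro C hC x hxC hxK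
    obtain ⟨D, hD, hxD⟩ := mem_apartmentRealisation.1 (hKF₀ hxK)
    exact hC (mem_sphericalNeighbours hD hxD hxC)
  obtain ⟨F', hF', hjoin⟩ := h F hF
  have hcpt : IsCompact (X.apartmentRealisation ρ (F ∪ F')) :=
    isCompact_apartmentRealisation (hF.union hF')
  obtain ⟨N₁, hN₁⟩ := hr₁.2 _ hcpt
  obtain ⟨N₂, hN₂⟩ := hr₂.2 _ hcpt
  have hcentre : ∀ C D, C ∉ F → X.JoinedOutside F C D →
      JoinedIn Kᶜ (X.centre ρ C) (X.centre ρ D) := by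
    intro C D hC hCD
    induction hCD with
    | refl => exact JoinedIn.refl (hchamber C hC (centre_mem_chamberRealisation C))
    | @tail D E _ h' ih =>
      obtain ⟨hD, hE, s, hs⟩ := h'
      let P := X.sphericalResidue {s} (cs.isSpherical_singleton s) D
      have hPE : P.vertex ρ ∈ X.chamberRealisation ρ E := by
        refine SphericalResidue.vertex_mem_chamberRealisation ?_
        change X.δ D E ∈ cs.parabolic _
        rw [hs]
        exact cs.simple_mem_parabolic (by simp)
      have hPD : P.vertex ρ ∈ X.chamberRealisation ρ D :=
        SphericalResidue.vertex_mem_chamberRealisation (mem_residue_self _ D)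
      exact (ih.trans ((joinedIn_centre hPD).symm.mono (hchamber D hD))).trans
        ((joinedIn_centre hPE).mono (hchamber E hE))
  refine ⟨max N₁ N₂, ?_⟩
  have hout : ∀ {r : ℝ≥0 → X.DavisRealisation ρ} {N : ℕ},
      r '' Set.Ici (N : ℝ≥0) ⊆ (X.apartmentRealisation ρ (F ∪ F'))ᶜ → N ≤ max N₁ N₂ →
      ∀ x ∈ r '' Set.Ici ((max N₁ N₂ : ℕ) : ℝ≥0),
        ∃ C, C ∉ F ∪ F' ∧ x ∈ X.chamberRealisation ρ C := by
    rintro r N hN hle _ ⟨t, ht, rfl⟩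
    have ht' : (N : ℝ≥0) ≤ t := le_trans (by exact_mod_cast hle) (Set.mem_Ici.1 ht)
    obtain ⟨C, hC⟩ := (r t).exists_mem_chamberRealisation
    exact ⟨C, fun h => hN ⟨t, ht', rfl⟩ (chamberRealisation_subset h hC), hC⟩
  intro x hx y hy
  obtain ⟨C, hCF, hxC⟩ := hout hN₁ (le_max_left _ _) x hx
  obtain ⟨D, hDF, hyD⟩ := hout hN₂ (le_max_right _ _) y hy
  rw [Set.mem_union, not_or] at hCF hDF
  exact (((joinedIn_centre hxC).mono (hchamber C hCF.1)).trans
    (hcentre C D hCF.1 (hjoin C hCF.2 D hDF.2))).trans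
    ((joinedIn_centre hyD).symm.mono (hchamber D hDF.1))

end WeylBuilding

end Ends

/-! ### Retractions onto apartments -/

/-- One-endedness passes to an isometrically embedded subspace that is the image of a retraction
for which the preimages of compact sets are relatively compact. -/
theorem IsOneEnded.of_retraction {Y Z : Type*} [PseudoEMetricSpace Y] [PseudoEMetricSpace Z]
    (h : IsOneEnded Z) {i : Y → Z} (hi : Isometry i) {p : Z → Y} (hp : Continuous p)
    (hpi : ∀ y, p (i y) = y)
    (hcpt : ∀ K : Set Y, IsCompact K → ∃ K' : Set Z, IsCompact K' ∧ p ⁻¹' K ⊆ K') :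
    IsOneEnded Y := by
  have hray : ∀ {r : ℝ≥0 → Y}, IsProperRay r → IsProperRay (i ∘ r) := by
    intro r hr
    refine ⟨hi.comp hr.1, fun K hK => ?_⟩
    obtain ⟨N, hN⟩ := hr.2 _ (hK.image hp)
    refine ⟨N, ?_⟩
    rintro _ ⟨t, ht, rfl⟩ hK
    exact hN ⟨t, ht, rfl⟩ ⟨_, hK, hpi _⟩
  intro r₁ r₂ hr₁ hr₂ K hK
  obtain ⟨K', hK', hsub⟩ := hcpt K hK
  obtain ⟨N, hN⟩ := h _ _ (hray hr₁) (hray hr₂) K' hK'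
  refine ⟨N, ?_⟩
  rintro _ ⟨s, hs, rfl⟩ _ ⟨t, ht, rfl⟩
  obtain ⟨q, hq⟩ := hN _ ⟨s, hs, rfl⟩ _ ⟨t, ht, rfl⟩
  exact ⟨(q.map hp).cast (hpi _).symm (hpi _).symm, fun u h => hq u (hsub h)⟩

section Retraction

variable {S W : Type*} [Fintype S] [Group W] {M : CoxeterMatrix S} {cs : CoxeterSystem M W}
  {Ch : Type*} {X : WeylBuilding cs Ch} {ρ : S → ℝ} {α : W → Ch}
  (hα : ∀ v w, X.δ (α v) (α w) = v⁻¹ * w)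

namespace WeylBuilding

include hα

theorem map_δ_map_apartment (x : (thin cs).DavisRealisation ρ) :
    (X.isTypePreserving_δ (α 1)).map ((isTypePreserving_of_δ_eq hα).map x) = x :=
  IsTypePreserving.map_map_eq _ _ fun R _ =>
    R.carrier_nonempty.imp fun w hw => ⟨hw, by rw [hα]; simp⟩

theorem map_apartment_map_δ {x : X.DavisRealisation ρ}
    (hx : x ∈ X.apartmentRealisation ρ (Set.range α)) :
    (isTypePreserving_of_δ_eq hα).map ((X.isTypePreserving_δ (α 1)).map x) = x := by
  obtain ⟨_, ⟨w, rfl⟩, hw⟩ := mem_apartmentRealisation.1 hx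
  exact IsTypePreserving.map_map_eq _ _ fun R hR => ⟨α w, hw R hR, by rw [hα]; simp⟩

theorem map_mem_apartmentRealisation (x : (thin cs).DavisRealisation ρ) :
    (isTypePreserving_of_δ_eq hα).map x ∈ X.apartmentRealisation ρ (Set.range α) := by
  obtain ⟨w, hw⟩ := x.exists_mem_chamberRealisation
  exact chamberRealisation_subset (Set.mem_range_self w) (IsTypePreserving.map_mem_chamberRealisation _ hw)

/-- The Davis realisation of the Coxeter complex is embedded isometrically as an apartment, since
there is a retraction that does not increase distances. -/
theorem isometry_map_apartment : Isometry ((isTypePreserving_of_δ_eq hα).map (ρ := ρ)) := by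
  intro x y
  refine le_antisymm (by simpa using (isTypePreserving_of_δ_eq hα).lipschitzWith_map x y) ?_
  have := (X.isTypePreserving_δ (α 1)).lipschitzWith_map
    ((isTypePreserving_of_δ_eq hα).map x) ((isTypePreserving_of_δ_eq hα).map y)
  rwa [map_δ_map_apartment hα, map_δ_map_apartment hα, ENNReal.coe_one, one_mul] at this

theorem isOneEnded_apartmentRealisation (hX : X.IsLocallyFinite) (hρ : ∀ s, 0 < ρ s)
    (h : IsOneEnded (X.DavisRealisation ρ)) :
    IsOneEnded (X.apartmentRealisation ρ (Set.range α)) := by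
  have hret := (X.isTypePreserving_δ (α 1)).lipschitzWith_map (ρ := ρ)
  refine h.of_retraction (i := Subtype.val) isometry_subtype_coe
    (p := fun x => ⟨_, map_mem_apartmentRealisation hα ((X.isTypePreserving_δ (α 1)).map x)⟩)
    (((isometry_map_apartment hα).continuous.comp hret.continuous).subtype_mk _)
    (fun y => Subtype.ext (map_apartment_map_δ hα y.2)) fun K hK => ?_
  obtain ⟨F, hF, hKF⟩ := exists_finite_of_isCompact isLocallyFinite_thin hρ
    (hK.image (hret.continuous.comp continuous_subtype_val))
  refine ⟨X.apartmentRealisation ρ {C | X.δ (α 1) C ∈ (thin cs).sphericalNeighbours F},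
    isCompact_apartmentRealisation (hX.finite_δ_mem _
      (isLocallyFinite_thin.finite_sphericalNeighbours hF)), fun x hx => ?_⟩
  obtain ⟨C, hC⟩ := x.exists_mem_chamberRealisation
  obtain ⟨w, hwF, hw⟩ := mem_apartmentRealisation.1
    (hKF (Set.mem_image_of_mem _ (Set.mem_preimage.1 hx)))
  simp only [Function.comp_apply, map_δ_map_apartment hα] at hw
  exact mem_apartmentRealisation.2 ⟨C, mem_sphericalNeighbours hwF hw
    (IsTypePreserving.map_mem_chamberRealisation _ hC), hC⟩

theorem isOneEnded_thin (h : IsOneEnded (X.apartmentRealisation ρ (Set.range α))) :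
    IsOneEnded ((thin cs).DavisRealisation ρ) := by
  have hret := (X.isTypePreserving_δ (α 1)).lipschitzWith_map (ρ := ρ)
  have hi : Isometry fun x : (thin cs).DavisRealisation ρ =>
      (⟨_, map_mem_apartmentRealisation hα x⟩ : X.apartmentRealisation ρ (Set.range α)) :=
    fun x y => isometry_map_apartment hα x y
  refine h.of_retraction hi (hret.continuous.comp continuous_subtype_val)
    (map_δ_map_apartment hα) fun K hK => ⟨_, hK.image hi.continuous, fun x hx => ?_⟩
  exact ⟨_, hx, Subtype.ext (map_apartment_map_δ hα x.2)⟩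

end WeylBuilding

end Retraction

theorem mainTheorem10 {S W Ch : Type*} [Fintype S] [Group W] {M : CoxeterMatrix S}
    (cs : CoxeterSystem M W) (X : WeylBuilding cs Ch) (hX : X.IsLocallyFinite)
    (ρ : S → ℝ) (hρ : ∀ s, 0 < ρ s)
    (𝒜 : Set (Set Ch)) (h𝒜 : X.IsApartmentSystem 𝒜) :
    IsOneEnded (X.DavisRealisation ρ) ↔
      ∀ A ∈ 𝒜, IsOneEnded (X.apartmentRealisation ρ A) := by
  constructor
  · intro h A hA
    obtain ⟨α, hα, rfl⟩ := h𝒜.1 A hA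
    exact WeylBuilding.isOneEnded_apartmentRealisation hα hX hρ h
  · intro h
    obtain ⟨C⟩ := X.nonempty
    obtain ⟨A, hA, -⟩ := h𝒜.2 C C
    obtain ⟨α, hα, rfl⟩ := h𝒜.1 A hA
    exact WeylBuilding.isOneEnded_of_isGalleryOneEnded hX hρ
      (WeylBuilding.isGalleryOneEnded_of_thin hX h𝒜
        (WeylBuilding.isGalleryOneEnded_of_isOneEnded WeylBuilding.isLocallyFinite_thin hρ
          (WeylBuilding.isOneEnded_thin hα (h _ hA))))
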